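/- All graphs are simple; $d_X$ is the path metric of a graph $X$. A connected graph $X$ is hyperbolic if for some $\delta\ge 0$, in every triangle of shortest paths every vertex of one side has distance at most $\delta$ to a vertex of another side. Two geodesic rays are equivalent if for some $M$ each contains infinitely many vertices of distance at most $M$ to the other; the classes form the hyperbolic boundary $\partial X$. It carries the topology in which $O\subseteq\partial X$ is open iff for every $\xi\in O$ there is $n$ such that $O$ contains every $\eta$ for which there are geodesic rays $r\in\xi$, $s\in\eta$ with Gromov products $(r_i\,|\,s_j)_o\ge n$ for all large $i,j$ ($o$ a base vertex, whose choice is irrelevant). A vertex sequence $(x_i)$ converges to $\eta\in\partial X$ if there are a geodesic ray $y_0y_1\ldots$ in $\eta$ and $n_i\to\infty$ such that every geodesic path from $x_i$ to $y_i$ has distance at least $n_i$ to $o$. A graph is quasi-transitive if its automorphism group has finitely many orbits on the vertices. Let $G$ and $H$ be connected, locally finite, hyperbolic, quasi-transitive graphs. Let $p,q\in\mathbb N\cup\{\infty\}$ and let $T$ be a $(p,q)$-semiregular tree with bipartition $\{U,V\}$ (all vertices in $U$ have degree $p$, all in $V$ have degree $q$). Let $S_k\subseteq V(G)$ $(0\le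 k<p)$ and $S'_\ell\subseteq V(H)$ $(0\le \ell<q)$ be non-empty sets (the adhesion sets) with $\sup_k \operatorname{diam}_G S_k<\infty$ and $\sup_\ell\operatorname{diam}_H S'_\ell<\infty$, let $\varphi_{k,\ell}\colon S_k\to S'_\ell$ be bijections, and let $c\colon E(T)\to\{(k,\ell)\mid 0\le k<p,\ 0\le\ell<q\}$ be such that at every $u\in U$ all first coordinates $k$, and at every $v\in V$ all second coordinates $\ell$, occur on the edges incident with that vertex. Let $G+_TH$ be the graph obtained from the disjoint union of copies $G^u$ of $G$ $(u\in U)$ and $H^v$ of $H$ $(v\in V)$ by adding, for every edge $uv$ of $T$ with $u\in U$, $v\in V$ and $c(uv)=(k,\ell)$ and every $x\in S_k$, an edge between the copy of $x$ in $G^u$ and the copy of $\varphi_{k,\ell}(x)$ in $H^v$. Then $G+_TH$ is connected and hyperbolic, and there is a bijection from the disjoint union $$f\colon\ \partial T\ \cup\ \bigcup_{u\in U}\partial G^u\ \cup\ \bigcup_{v\in V}\partial H^v\ \longrightarrow\ \partial(G+_TH)$$ such that: 1. the preimage under $f$ of each connected component of $\partial(G+_TH)$ is a connected component of $\partial T$,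 of some $\partial G^u$ or of some $\partial H^v$; 2. every sequence of vertices in some $G^u$ or $H^v$ that converges there to a boundary point $\eta$ of $G^u$ or $H^v$ converges to $f(\eta)$ in $G+_TH$; 3. every sequence $(z_i)$ of vertices with $z_i$ in $G^{t_i}$ or $H^{t_i}$, where $(t_i)$ converges in $T$ to some $\eta\in\partial T$, converges to $f(\eta)$ in $G+_TH$. Moreover $f$ is canonical: it is the only map between these sets that satisfies 2 and 3. -/

import Mathlib

noncomputable section

namespace TreeAmalgam

/-! ### Hyperbolic graphs and their boundaries -/

section Hyperbolic

variable {X : Type*}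

/-- Every vertex has finitely many neighbours. -/
def IsLocallyFinite (G : SimpleGraph X) : Prop :=
  ∀ x, (G.neighborSet x).Finite

/-- The automorphism group has only finitely many orbits on the vertex set. -/
def IsQuasiTransitive (G : SimpleGraph X) : Prop :=
  ∃ F : Set X, F.Finite ∧ ∀ x, ∃ y ∈ F, ∃ a : G ≃g G, a y = x

/-- A walk is a shortest path between its end vertices. -/
def IsShortest {G : SimpleGraph X} {x y : X} (P : G.Walk x y) : Prop :=
  P.length = G.dist x y

/-- Geodesic triangles are `δ`-thin: every vertex of one side has distance at most `δ` to a vertex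
on one of the two other sides. -/
def IsDeltaHyperbolic (G : SimpleGraph X) (δ : ℝ) : Prop :=
  ∀ (x y z : X) (P₁ : G.Walk x y) (P₂ : G.Walk y z) (P₃ : G.Walk x z),
    IsShortest P₁ → IsShortest P₂ → IsShortest P₃ →
      ∀ a ∈ P₁.support, ∃ b, (b ∈ P₂.support ∨ b ∈ P₃.support) ∧ (G.dist a b : ℝ) ≤ δ

def IsHyperbolic (G : SimpleGraph X) : Prop :=
  ∃ δ : ℝ, 0 ≤ δ ∧ IsDeltaHyperbolic G δ

/-- Geodesic rays, given by the sequence of their vertices.  Consecutive vertices have distance 1,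
that is, they are adjacent. -/
structure GeodesicRay (G : SimpleGraph X) where
  vertex : ℕ → X
  geodesic : ∀ i k : ℕ, G.dist (vertex i) (vertex (i + k)) = k

/-- Two geodesic rays are equivalent if, for some `M`, on each of them there are infinitely many
vertices of distance at most `M` to the other one. -/
def GeodesicRay.Equivalent {G : SimpleGraph X} (r s : GeodesicRay G) : Prop :=
  ∃ M : ℕ, {i | ∃ j, G.dist (r.vertex i) (s.vertex j) ≤ M}.Infinite ∧
    {j | ∃ i, G.dist (s.vertex j) (r.vertex i) ≤ M}.Infinite

/-- The hyperbolic boundary: geodesic rays up to equivalence. -/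
def Boundary (G : SimpleGraph X) : Type _ :=
  Quot (GeodesicRay.Equivalent (G := G))

/-- The boundary point that contains a given geodesic ray. -/
def GeodesicRay.point {G : SimpleGraph X} (r : GeodesicRay G) : Boundary G :=
  Quot.mk _ r

/-- The sequence `x` of vertices converges to the boundary point `η`: for some geodesic ray
`y 0, y 1, …` in `η`, the distance of a base vertex `o` to all geodesic paths from `x i` to `y i`
is bounded below by a sequence that goes to infinity. -/
def ConvergesTo (G : SimpleGraph X) (x : ℕ → X) (η : Boundary G) : Prop :=
  ∃ y : GeodesicRay G, y.point = η ∧ ∀ o : X, ∃ n : ℕ → ℕ,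
    Filter.Tendsto n Filter.atTop Filter.atTop ∧
      ∀ (i : ℕ) (P : G.Walk (x i) (y.vertex i)), IsShortest P →
        ∀ a ∈ P.support, n i ≤ G.dist o a

/-- The Gromov product of `x` and `y` with respect to the base vertex `o`. -/
def gromovProduct (G : SimpleGraph X) (o x y : X) : ℝ :=
  ((G.dist o x : ℝ) + G.dist o y - G.dist x y) / 2

/-- `Near G o n ξ η` says that `η` lies in the basic neighbourhood with parameter `n` of `ξ`:
there are geodesic rays `r` in `ξ` and `s` in `η` whose Gromov products `(r i | s j)` with respect
to `o` are at least `n` for all large `i` and `j`. -/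
def Near (G : SimpleGraph X) (o : X) (n : ℕ) (ξ η : Boundary G) : Prop :=
  ∃ r s : GeodesicRay G, r.point = ξ ∧ s.point = η ∧
    ∃ N : ℕ, ∀ i ≥ N, ∀ j ≥ N, (n : ℝ) ≤ gromovProduct G o (r.vertex i) (s.vertex j)

theorem Near.mono {G : SimpleGraph X} {o : X} {m n : ℕ} (hmn : m ≤ n) {ξ η : Boundary G}
    (h : Near G o n ξ η) : Near G o m ξ η := by
  obtain ⟨r, s, hr, hs, N, hN⟩ := h
  exact ⟨r, s, hr, hs, N, fun i hi j hj => le_trans (Nat.cast_le.mpr hmn) (hN i hi j hj)⟩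

/-- The usual topology on the hyperbolic boundary: a set is open if it contains a basic
neighbourhood of each of its points.  (For connected graphs the choice of the base vertex `o` makes
no difference.) -/
instance (G : SimpleGraph X) : TopologicalSpace (Boundary G) where
  IsOpen O := ∀ ξ ∈ O, ∀ o : X, ∃ n : ℕ, ∀ η, Near G o n ξ η → η ∈ O
  isOpen_univ := fun _ _ _ => ⟨0, fun _ _ => trivial⟩
  isOpen_inter := by
    intro A B hA hB ξ hξ o
    obtain ⟨m, hm⟩ := hA ξ hξ.1 o
    obtain ⟨n, hn⟩ := hB ξ hξ.2 o
    exact ⟨max m n, fun η h =>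
      ⟨hm η (h.mono (le_max_left m n)), hn η (h.mono (le_max_right m n))⟩⟩
  isOpen_sUnion := by
    intro S hS ξ hξ o
    obtain ⟨A, hA, hξA⟩ := hξ
    obtain ⟨n, hn⟩ := hS A hA ξ hξA o
    exact ⟨n, fun η h => ⟨A, hA, hn η h⟩⟩

end Hyperbolic

/-! ### Amalgamating two graphs along a semiregular tree -/

/-- `T` is a `(p, q)`-semiregular tree with canonical bipartition `U`, `V` of its vertex set. -/
structure IsSemiregularTree {W : Type*} (T : SimpleGraph W) (U V : Set W) (p q : ℕ∞) : Prop where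
  isTree : T.IsTree
  bipartite : T.IsBipartiteWith U V
  cover : U ∪ V = Set.univ
  degree_left : ∀ u ∈ U, (T.neighborSet u).encard = p
  degree_right : ∀ v ∈ V, (T.neighborSet v).encard = q

/-- The labels `0 ≤ k < p`, where `p` may be infinite. -/
abbrev Label (p : ℕ∞) : Type := {k : ℕ // (k : ℕ∞) < p}

/-- The data by which copies of two graphs with vertex sets `A` and `B` are glued along the tree
`T`: (non-empty) adhesion sets in both graphs, a bijection between any adhesion set of the first
and any of the second graph (in particular all adhesion sets have the same size), and a labelling
of the edges of `T` by pairs of labels such that at every vertex of `U` all first labels and at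
every vertex of `V` all second labels occur. -/
structure Gluing (A B : Type*) {W : Type*} (T : SimpleGraph W) (U V : Set W) (p q : ℕ∞) where
  adhesionLeft : Label p → Set A
  adhesionRight : Label q → Set B
  nonempty_left : ∀ k, (adhesionLeft k).Nonempty
  nonempty_right : ∀ l, (adhesionRight l).Nonempty
  identify : ∀ k l, adhesionLeft k ≃ adhesionRight l
  label : T.edgeSet → Label p × Label q
  exhaust_left : ∀ u ∈ U, ∀ k, ∃ e : T.edgeSet, u ∈ (e : Sym2 W) ∧ (label e).1 = k
  exhaust_right : ∀ v ∈ V, ∀ l, ∃ e : T.edgeSet, v ∈ (e : Sym2 W) ∧ (label e).2 = l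

section Amalgam

variable {A B W : Type*} {T : SimpleGraph W} {U V : Set W} {p q : ℕ∞}

/-- Bounded adhesion: the diameters of the adhesion sets are bounded. -/
def Gluing.BoundedAdhesion (D : Gluing A B T U V p q) (G : SimpleGraph A) (H : SimpleGraph B) :
    Prop :=
  ∃ N : ℕ, (∀ k, ∀ x ∈ D.adhesionLeft k, ∀ y ∈ D.adhesionLeft k, G.dist x y ≤ N) ∧
    (∀ l, ∀ x ∈ D.adhesionRight l, ∀ y ∈ D.adhesionRight l, H.dist x y ≤ N)

/-- The vertices of the disjoint union of the copies `G^u`, `u ∈ U`, of `G` and `H^v`, `v ∈ V`,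
of `H`. -/
abbrev Vertex (A B : Type*) {W : Type*} (U V : Set W) : Type _ := (U × A) ⊕ (V × B)

/-- The vertex `t` of the tree such that the given vertex lies in `G^t` or `H^t`. -/
def treeVertex : Vertex A B U V → W
  | .inl z => z.1
  | .inr z => z.1

/-- The vertex `x` of `G^u` and the vertex `y` of `H^v` are joined by a new edge: `uv` is an edge
of the tree, with label `(k, l)` say, and `y` is the image of `x` under the bijection from the
`k`-th adhesion set of `G` to the `l`-th adhesion set of `H`. -/
def Gluing.NewEdge (D : Gluing A B T U V p q) (u : U) (x : A) (v : V) (y : B) : Prop :=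
  ∃ (e : T.Adj u v)
    (hx : x ∈ D.adhesionLeft (D.label ⟨s((u : W), (v : W)), e⟩).1),
      (D.identify _ (D.label ⟨s((u : W), (v : W)), e⟩).2 ⟨x, hx⟩ : B) = y

/-- The graph `G +_T H`: the disjoint union of all `G^u` and `H^v` together with the new edges. -/
def Gluing.sumGraph (D : Gluing A B T U V p q) (G : SimpleGraph A) (H : SimpleGraph B) :
    SimpleGraph (Vertex A B U V) where
  Adj
    | .inl (u, x), .inl (u', x') => u = u' ∧ G.Adj x x'
    | .inr (v, y), .inr (v', y') => v = v' ∧ H.Adj y y'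
    | .inl (u, x), .inr (v, y) => D.NewEdge u x v y
    | .inr (v, y), .inl (u, x) => D.NewEdge u x v y
  symm := ⟨by
    rintro (⟨u, x⟩ | ⟨v, y⟩) (⟨u', x'⟩ | ⟨v', y'⟩) h
    · exact ⟨h.1.symm, h.2.symm⟩
    · exact h
    · exact h
    · exact ⟨h.1.symm, h.2.symm⟩⟩
  loopless := ⟨by
    rintro (⟨u, x⟩ | ⟨v, y⟩) h
    · exact G.irrefl h.2
    · exact H.irrefl h.2⟩

/-- The disjoint union of `∂T`, all `∂G^u` for `u ∈ U`, and all `∂H^v` for `v ∈ V`, where `G^u` and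
`H^v` are copies of `G` and `H`. -/
abbrev PieceBoundary (T : SimpleGraph W) (U V : Set W) (G : SimpleGraph A) (H : SimpleGraph B) :
    Type _ :=
  Boundary T ⊕ (U × Boundary G) ⊕ (V × Boundary H)

variable {G : SimpleGraph A} {H : SimpleGraph B}

/-- The copy in `PieceBoundary` of a boundary point of `T`. -/
def ofTree (U V : Set W) (G : SimpleGraph A) (H : SimpleGraph B) (η : Boundary T) :
    PieceBoundary T U V G H := .inl η

/-- The copy in `∂G^u` of a boundary point of `G`. -/
def ofLeft (T : SimpleGraph W) (V : Set W) (H : SimpleGraph B) (u : U) (η : Boundary G) :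
    PieceBoundary T U V G H := .inr (.inl (u, η))

/-- The copy in `∂H^v` of a boundary point of `H`. -/
def ofRight (T : SimpleGraph W) (U : Set W) (G : SimpleGraph A) (v : V) (η : Boundary H) :
    PieceBoundary T U V G H := .inr (.inr (v, η))

/-- The preimage under `f` of every connected component of `∂(G +_T H)` is a connected component of
`∂T`, of some `∂G^u` or of some `∂H^v`. -/
def ComponentsPullBack (D : Gluing A B T U V p q)
    (f : PieceBoundary T U V G H → Boundary (D.sumGraph G H)) : Prop :=
  ∀ ξ : Boundary (D.sumGraph G H),
    (∃ η : Boundary T, f ⁻¹' connectedComponent ξ = ofTree U V G H '' connectedComponent η) ∨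
    (∃ (u : U) (η : Boundary G),
      f ⁻¹' connectedComponent ξ = ofLeft T V H u '' connectedComponent η) ∨
    (∃ (v : V) (η : Boundary H),
      f ⁻¹' connectedComponent ξ = ofRight T U G v '' connectedComponent η)

/-- Every sequence in some `G^u` or `H^v` that converges there to a boundary point `η` converges to
`f η` in `G +_T H`. -/
def RespectsPieces (D : Gluing A B T U V p q)
    (f : PieceBoundary T U V G H → Boundary (D.sumGraph G H)) : Prop :=
  (∀ (u : U) (x : ℕ → A) (η : Boundary G), ConvergesTo G x η →
    ConvergesTo (D.sumGraph G H) (fun i => .inl (u, x i)) (f (ofLeft T V H u η))) ∧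
  (∀ (v : V) (y : ℕ → B) (η : Boundary H), ConvergesTo H y η →
    ConvergesTo (D.sumGraph G H) (fun i => .inr (v, y i)) (f (ofRight T U G v η)))

/-- Every sequence of vertices `z i` in `G^(t i)` or `H^(t i)` such that `t` converges to a boundary
point `η` of `T` converges to `f η` in `G +_T H`. -/
def RespectsTree (D : Gluing A B T U V p q)
    (f : PieceBoundary T U V G H → Boundary (D.sumGraph G H)) : Prop :=
  ∀ (z : ℕ → Vertex A B U V) (η : Boundary T), ConvergesTo T (fun i => treeVertex (z i)) η →
    ConvergesTo (D.sumGraph G H) z (f (ofTree U V G H η))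

end Amalgam

end TreeAmalgam

end

/-! The map `treeVertex` arranges the amalgam `Γ` along `T`; its fibres are the copies of `G` and
`H`. Almost the whole argument uses only the data in `TreeOfGraphs`: uniformly thin fibres with
finite balls, and bounded sets where neighbouring fibres meet. `Γ` itself need not be locally
finite.

Hyperbolicity. Fix one edge of `Γ` over every edge of `T` (a gate) and project a vertex outside a
fibre to the gate of that fibre in its direction. Bounded adhesion makes this projection Lipschitz,
so fibres are undistorted (`fibre_dist_le`). Joining consecutive gates by shortest paths inside the
fibres gives a connected set `gatePath x y` for every pair. These sets form thin triangles, because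
a triangle of them either coincides with a side over a given fibre or is a triangle of that fibre.
By the guessing-geodesics criterion (`GuessedGeodesics.exists_bound`), such a family is uniformly
close to the geodesics, and `Γ` is hyperbolic.

Boundary maps. Boundary points are handled through Gromov products: equivalence of rays, convergence
and neighbourhoods all become statements on products, up to constants. Closeness of gate paths to
geodesics compares the products of `Γ` with those of `T` (`tree_gromovProduct_le`) and of a fibre
(`gromovProduct_piece_le`, `isGromovProper_piece`). Hence the inclusion of each fibre, and any
section of `treeVertex`, induces a continuous map of boundaries once limits are known to be
represented by rays. That is a König argument (`exists_ray_of_infinite`) in which finite balls of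
the fibres replace local finiteness.

Bijectivity and components. A ray of `Γ` either meets some fibre infinitely often and is a limit of
that fibre, or it follows a ray of `T`. Gromov products across an edge of `T` are bounded, so each
edge cuts the boundary into two clopen sets. These separate boundary points coming from different
fibres or from different ends of `T`. So the points from `T` are singleton components, each fibre
boundary is embedded as a closed set that contains the component of each of its points, and `f` is
injective. Uniqueness of `f` is uniqueness of limits. -/

open Filter

namespace TreeAmalgam

/-! ### Intervals and Gromov products -/

section Metric

variable {X : Type*} {Γ : SimpleGraph X}

/-- The vertices on shortest paths between `x` and `y`. -/
def interval (Γ : SimpleGraph X) (x y : X) : Set X :=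
  {w | Γ.dist x w + Γ.dist w y = Γ.dist x y}

theorem left_mem_interval (x y : X) : x ∈ interval Γ x y := by simp [interval]

theorem right_mem_interval (x y : X) : y ∈ interval Γ x y := by simp [interval]

theorem mem_interval_comm {x y w : X} : w ∈ interval Γ x y ↔ w ∈ interval Γ y x := by
  simp only [interval, Set.mem_ofPred_eq]
  rw [Γ.dist_comm (u := x) (v := w), Γ.dist_comm (u := w) (v := y), Γ.dist_comm (u := x) (v := y),
    add_comm]

theorem mem_interval_trans (hΓ : Γ.Connected) {o v w y : X} (hv : v ∈ interval Γ o y)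
    (hw : w ∈ interval Γ v y) : w ∈ interval Γ o y ∧ v ∈ interval Γ o w := by
  simp only [interval, Set.mem_ofPred_eq] at *
  have h₁ := hΓ.dist_triangle (u := o) (v := v) (w := w)
  have h₂ := hΓ.dist_triangle (u := o) (v := w) (w := y)
  constructor <;> omega

theorem mem_interval_of_mem_of_mem (hΓ : Γ.Connected) {o v w y : X} (hw : w ∈ interval Γ o y)
    (hv : v ∈ interval Γ o w) : v ∈ interval Γ o y := by
  simp only [interval, Set.mem_ofPred_eq] at *
  have h₁ := hΓ.dist_triangle (u := v) (v := w) (w := y)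
  have h₂ := hΓ.dist_triangle (u := o) (v := v) (w := y)
  omega

theorem gromovProduct_comm (o x y : X) : gromovProduct Γ o x y = gromovProduct Γ o y x := by
  simp only [gromovProduct]
  rw [Γ.dist_comm (u := x) (v := y)]
  ring

theorem dist_triangle_cast (hΓ : Γ.Connected) (x y z : X) :
    (Γ.dist x z : ℝ) ≤ Γ.dist x y + Γ.dist y z := by
  exact_mod_cast hΓ.dist_triangle

theorem gromovProduct_nonneg (hΓ : Γ.Connected) (o x y : X) : 0 ≤ gromovProduct Γ o x y := by
  have := dist_triangle_cast hΓ x o y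
  simp only [gromovProduct]
  rw [Γ.dist_comm (u := x) (v := o)] at this
  linarith

theorem gromovProduct_le_dist_of_mem (hΓ : Γ.Connected) {o x y w : X}
    (hw : w ∈ interval Γ x y) : gromovProduct Γ o x y ≤ Γ.dist o w := by
  have h : (Γ.dist x w : ℝ) + Γ.dist w y = Γ.dist x y := by exact_mod_cast hw
  have h₁ := dist_triangle_cast hΓ o w x
  have h₂ := dist_triangle_cast hΓ o w y
  rw [Γ.dist_comm (u := w) (v := x)] at h₁
  simp only [gromovProduct]
  linarith

theorem gromovProduct_eq_dist_of_mem {o y w : X}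
    (hw : w ∈ interval Γ o y) : gromovProduct Γ o w y = Γ.dist o w := by
  have h : (Γ.dist o w : ℝ) + Γ.dist w y = Γ.dist o y := by exact_mod_cast hw
  simp only [gromovProduct]
  linarith

theorem gromovProduct_le_add_dist_base (hΓ : Γ.Connected) (o o' x y : X) :
    gromovProduct Γ o x y ≤ gromovProduct Γ o' x y + Γ.dist o o' := by
  have h₁ := dist_triangle_cast hΓ o o' x
  have h₂ := dist_triangle_cast hΓ o o' y
  simp only [gromovProduct]
  linarith

theorem dist_le_of_gromovProduct {o x y : X} :
    (Γ.dist x y : ℝ) = Γ.dist o x + Γ.dist o y - 2 * gromovProduct Γ o x y := by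
  simp only [gromovProduct]; ring

/-- `γ 0, …, γ n` is a shortest path. -/
def IsGeodesicUpTo (Γ : SimpleGraph X) (γ : ℕ → X) (n : ℕ) : Prop :=
  ∀ i j, i ≤ j → j ≤ n → Γ.dist (γ i) (γ j) = j - i

theorem dist_le_of_forall_succ (hΓ : Γ.Connected) {γ : ℕ → X} {n : ℕ}
    (h : ∀ i < n, Γ.dist (γ i) (γ (i + 1)) ≤ 1) {i j : ℕ} (hij : i ≤ j) (hj : j ≤ n) :
    Γ.dist (γ i) (γ j) ≤ j - i := by
  induction j, hij using Nat.le_induction with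
  | base => simp
  | succ j hij ih =>
    have h₁ := ih (by omega)
    have h₂ := h j (by omega)
    have h₃ := hΓ.dist_triangle (u := γ i) (v := γ j) (w := γ (j + 1))
    omega

theorem isGeodesicUpTo_of_dist (hΓ : Γ.Connected) {γ : ℕ → X} {n : ℕ}
    (h : ∀ i < n, Γ.dist (γ i) (γ (i + 1)) ≤ 1) (hn : n ≤ Γ.dist (γ 0) (γ n)) :
    IsGeodesicUpTo Γ γ n := by
  intro i j hij hj
  have h₁ := dist_le_of_forall_succ hΓ h hij hj
  have h₂ := dist_le_of_forall_succ hΓ h (Nat.zero_le i) (hij.trans hj)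
  have h₃ := dist_le_of_forall_succ hΓ h hj le_rfl
  have h₄ := hΓ.dist_triangle (u := γ 0) (v := γ i) (w := γ n)
  have h₅ := hΓ.dist_triangle (u := γ i) (v := γ j) (w := γ n)
  omega

theorem isGeodesicUpTo_getVert (hΓ : Γ.Connected) {x y : X} {P : Γ.Walk x y}
    (hP : IsShortest P) : IsGeodesicUpTo Γ P.getVert P.length := by
  apply isGeodesicUpTo_of_dist hΓ
  · intro i hi
    exact (SimpleGraph.dist_eq_one_iff_adj.2 (P.adj_getVert_succ hi)).le
  · rw [P.getVert_zero, P.getVert_length, ← hP]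

theorem IsGeodesicUpTo.mem_interval {γ : ℕ → X} {n : ℕ} (h : IsGeodesicUpTo Γ γ n) {i j k : ℕ}
    (hij : i ≤ j) (hjk : j ≤ k) (hk : k ≤ n) : γ j ∈ interval Γ (γ i) (γ k) := by
  simp only [interval, Set.mem_ofPred_eq]
  rw [h i j hij (hjk.trans hk), h j k hjk hk, h i k (hij.trans hjk) hk]
  omega

theorem exists_isShortest (hΓ : Γ.Connected) (x y : X) : ∃ P : Γ.Walk x y, IsShortest P :=
  hΓ.exists_walk_length_eq_dist x y

theorem exists_geodesic (hΓ : Γ.Connected) (x y : X) :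
    ∃ γ : ℕ → X, γ 0 = x ∧ γ (Γ.dist x y) = y ∧ IsGeodesicUpTo Γ γ (Γ.dist x y) := by
  obtain ⟨P, hP⟩ := exists_isShortest hΓ x y
  have := isGeodesicUpTo_getVert hΓ hP
  rw [hP] at this
  exact ⟨P.getVert, P.getVert_zero, by rw [← hP]; exact P.getVert_length, this⟩

theorem IsShortest.mem_interval {x y : X} {P : Γ.Walk x y} (hP : IsShortest P) {a : X}
    (ha : a ∈ P.support) : a ∈ interval Γ x y := by
  classical
  have h₁ := congrArg SimpleGraph.Walk.length (P.take_spec ha)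
  rw [SimpleGraph.Walk.length_append, hP] at h₁
  have h₂ := SimpleGraph.dist_le (P.takeUntil a ha)
  have h₃ := SimpleGraph.dist_le (P.dropUntil a ha)
  have h₄ := (P.takeUntil a ha).reachable.dist_triangle_left y
  simp only [interval, Set.mem_ofPred_eq]
  omega

theorem exists_isShortest_of_mem_interval (hΓ : Γ.Connected) {x y w : X}
    (hw : w ∈ interval Γ x y) : ∃ P : Γ.Walk x y, IsShortest P ∧ w ∈ P.support := by
  obtain ⟨P, hP⟩ := exists_isShortest hΓ x w
  obtain ⟨Q, hQ⟩ := exists_isShortest hΓ w y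
  refine ⟨P.append Q, ?_, ?_⟩
  · simp only [IsShortest, SimpleGraph.Walk.length_append] at *
    rw [hP, hQ]; exact hw
  · simp

/-- The first vertex after `x` on a shortest path to `y`. -/
theorem exists_adj_mem_interval (hΓ : Γ.Connected) {x y : X} (hxy : x ≠ y) :
    ∃ z, Γ.Adj x z ∧ z ∈ interval Γ x y := by
  obtain ⟨γ, h0, hn, hγ⟩ := exists_geodesic hΓ x y
  have hpos := hΓ.pos_dist_of_ne hxy
  refine ⟨γ 1, ?_, ?_⟩
  · rw [← SimpleGraph.dist_eq_one_iff_adj, ← h0]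
    exact hγ 0 1 (by omega) hpos
  · have := hγ.mem_interval (Nat.zero_le 1) hpos le_rfl
    rwa [h0, hn] at this

/-- A shortest path that leaves the set `S` does so along some edge. -/
theorem exists_boundary_mem_interval (hΓ : Γ.Connected) {x y : X} {S : Set X} (hx : x ∈ S)
    (hy : y ∉ S) : ∃ a b, Γ.Adj a b ∧ a ∈ S ∧ b ∉ S ∧ a ∈ interval Γ x y ∧ b ∈ interval Γ x y := by
  obtain ⟨P, hP⟩ := exists_isShortest hΓ x y
  obtain ⟨d, hd, h₁, h₂⟩ := P.exists_boundary_dart S hx hy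
  exact ⟨d.fst, d.snd, d.adj, h₁, h₂,
    hP.mem_interval (P.dart_fst_mem_support_of_mem_darts hd),
    hP.mem_interval (P.dart_snd_mem_support_of_mem_darts hd)⟩

/-! ### Thin triangles and the four-point inequality -/

/-- Thinness of triangles whose sides are intervals. -/
def ThinIntervals (Γ : SimpleGraph X) (δ : ℕ) : Prop :=
  ∀ x y z w, w ∈ interval Γ x y → ∃ w', (w' ∈ interval Γ x z ∨ w' ∈ interval Γ z y) ∧
    Γ.dist w w' ≤ δ

/-- The four-point inequality for Gromov products. -/
def FourPoint (Γ : SimpleGraph X) (c : ℝ) : Prop :=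
  ∀ o x y z, min (gromovProduct Γ o x y) (gromovProduct Γ o y z) - c ≤ gromovProduct Γ o x z

theorem IsHyperbolic.thinIntervals (hΓ : Γ.Connected) (h : IsHyperbolic Γ) :
    ∃ δ, ThinIntervals Γ δ := by
  obtain ⟨δ, -, h⟩ := h
  refine ⟨⌈δ⌉₊, fun x y z w hw => ?_⟩
  obtain ⟨P₁, hP₁, hwP⟩ := exists_isShortest_of_mem_interval hΓ hw
  obtain ⟨P₂, hP₂⟩ := exists_isShortest hΓ y z
  obtain ⟨P₃, hP₃⟩ := exists_isShortest hΓ x z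
  obtain ⟨b, hb, hd⟩ := h x y z P₁ P₂ P₃ hP₁ hP₂ hP₃ w hwP
  refine ⟨b, ?_, by exact_mod_cast hd.trans (Nat.le_ceil δ)⟩
  rcases hb with hb | hb
  · exact Or.inr (mem_interval_comm.1 (hP₂.mem_interval hb))
  · exact Or.inl (hP₃.mem_interval hb)

/-- With `gromovProduct_le_dist_of_mem` this identifies the Gromov product with the distance from
`o` to the interval, up to a constant. On the way from `x` to `y`, the last vertex before the path
leaves the `δ`-neighbourhood of the side `x o` is close to both other sides of the triangle. -/
theorem ThinIntervals.exists_dist_le (hΓ : Γ.Connected) {δ : ℕ} (h : ThinIntervals Γ δ)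
    (o x y : X) : ∃ w ∈ interval Γ x y, (Γ.dist o w : ℝ) ≤ gromovProduct Γ o x y + (2 * δ + 1) := by
  -- Detours through `a` and `b` cost only the sum of the two distances, and that sum is what enters
  -- the final bound.
  suffices H : ∃ w ∈ interval Γ x y, ∃ a ∈ interval Γ x o, ∃ b ∈ interval Γ o y,
      Γ.dist w a ≤ δ + 1 ∧ Γ.dist w b ≤ δ + 1 ∧ Γ.dist w a + Γ.dist w b ≤ 2 * δ + 1 by
    obtain ⟨w, hw, a, ha, b, hb, -, -, hab⟩ := H
    refine ⟨w, hw, ?_⟩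
    have h₀ : (Γ.dist x w : ℝ) + Γ.dist w y = Γ.dist x y := by exact_mod_cast hw
    have h₁ : (Γ.dist x a : ℝ) + Γ.dist a o = Γ.dist x o := by exact_mod_cast ha
    have h₂ : (Γ.dist o b : ℝ) + Γ.dist b y = Γ.dist o y := by exact_mod_cast hb
    have h₃ : (Γ.dist w a : ℝ) + Γ.dist w b ≤ 2 * δ + 1 := by exact_mod_cast hab
    have t₁ := dist_triangle_cast hΓ x a w
    have t₂ := dist_triangle_cast hΓ o a w
    have t₃ := dist_triangle_cast hΓ o b w
    have t₄ := dist_triangle_cast hΓ w b y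
    simp only [gromovProduct]
    rw [Γ.dist_comm (u := a) (v := w)] at t₁ t₂
    rw [Γ.dist_comm (u := o) (v := a)] at t₂
    rw [Γ.dist_comm (u := b) (v := w)] at t₃
    rw [Γ.dist_comm (u := x) (v := o)] at h₁
    linarith
  by_cases hy : ∃ a ∈ interval Γ x o, Γ.dist y a ≤ δ
  · obtain ⟨a, ha, hd⟩ := hy
    refine ⟨y, right_mem_interval _ _, a, ha, y, right_mem_interval _ _, ?_⟩
    simp only [SimpleGraph.dist_self]
    omega
  · obtain ⟨c, d, hcd, ⟨a, ha, hca⟩, hd, hcI, hdI⟩ :=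
      exists_boundary_mem_interval hΓ (x := x) (y := y)
        (S := {w | ∃ a ∈ interval Γ x o, Γ.dist w a ≤ δ}) ⟨x, left_mem_interval _ _, by simp⟩ hy
    obtain ⟨b, hb, hdb⟩ := h x y o d hdI
    have hb : b ∈ interval Γ o y := hb.resolve_left fun hb => hd ⟨b, hb, hdb⟩
    have h₁ := SimpleGraph.dist_eq_one_iff_adj.2 hcd
    have h₂ := hΓ.dist_triangle (u := c) (v := d) (w := b)
    exact ⟨c, hcI, a, ha, b, hb, by omega, by omega, by omega⟩

/-- A vertex of the side `x z` nearly realizing the Gromov product is moved by at most `δ` to one of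
the other sides, whose distance to `o` bounds its own product from above: `3δ + 1 = (2δ + 1) + δ`.
-/
theorem ThinIntervals.fourPoint (hΓ : Γ.Connected) {δ : ℕ} (h : ThinIntervals Γ δ) :
    FourPoint Γ (3 * δ + 1) := by
  intro o x y z
  obtain ⟨w, hw, hd⟩ := h.exists_dist_le hΓ o x z
  obtain ⟨w', hw', hd'⟩ := h x z y w hw
  have h₁ : (Γ.dist w w' : ℝ) ≤ δ := by exact_mod_cast hd'
  have h₂ := dist_triangle_cast hΓ o w w'
  rcases hw' with hw' | hw'
  · have h₃ := gromovProduct_le_dist_of_mem hΓ (o := o) hw'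
    have := min_le_left (gromovProduct Γ o x y) (gromovProduct Γ o y z)
    linarith
  · have h₃ := gromovProduct_le_dist_of_mem hΓ (o := o) hw'
    have := min_le_right (gromovProduct Γ o x y) (gromovProduct Γ o y z)
    linarith

/-- Take the vertex of `P` at the same distance from `x` as `w`. Both have Gromov product `Γ.dist x
w` with `y`, so the four-point inequality keeps them close. This passes from intervals back to
prescribed shortest paths. -/
theorem ThinIntervals.exists_mem_support (hΓ : Γ.Connected) {δ : ℕ} (h : ThinIntervals Γ δ)
    {x y w : X} (hw : w ∈ interval Γ x y) {P : Γ.Walk x y} (hP : IsShortest P) :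
    ∃ b ∈ P.support, (Γ.dist w b : ℝ) ≤ 2 * (3 * δ + 1) := by
  refine ⟨P.getVert (Γ.dist x w), P.getVert_mem_support _, ?_⟩
  set b := P.getVert (Γ.dist x w)
  have hxw : Γ.dist x w ≤ P.length := by
    rw [hP, ← hw]; omega
  have hb : b ∈ interval Γ x y := hP.mem_interval (P.getVert_mem_support _)
  have hxb : Γ.dist x b = Γ.dist x w := by
    have := isGeodesicUpTo_getVert hΓ hP 0 _ (Nat.zero_le _) hxw
    rwa [P.getVert_zero, Nat.sub_zero] at this
  have h4 := h.fourPoint hΓ x w y b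
  rw [gromovProduct_eq_dist_of_mem hw, gromovProduct_comm x y b, gromovProduct_eq_dist_of_mem hb,
    hxb, min_self] at h4
  rw [dist_le_of_gromovProduct (o := x), hxb]
  linarith

theorem ThinIntervals.isHyperbolic (hΓ : Γ.Connected) {δ : ℕ} (h : ThinIntervals Γ δ) :
    IsHyperbolic Γ := by
  refine ⟨δ + 2 * (3 * δ + 1), by positivity, fun x y z P₁ P₂ P₃ hP₁ hP₂ hP₃ a ha => ?_⟩
  obtain ⟨w, hw, hd⟩ := h x y z a (hP₁.mem_interval ha)
  have hd : (Γ.dist a w : ℝ) ≤ δ := by exact_mod_cast hd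
  rcases hw with hw | hw
  · obtain ⟨b, hb, hd'⟩ := h.exists_mem_support hΓ hw hP₃
    have := dist_triangle_cast hΓ a w b
    exact ⟨b, Or.inr hb, by linarith⟩
  · obtain ⟨b, hb, hd'⟩ := h.exists_mem_support hΓ (mem_interval_comm.1 hw) hP₂
    have := dist_triangle_cast hΓ a w b
    exact ⟨b, Or.inl hb, by linarith⟩

end Metric

/-! ### Sequences, rays and boundary points -/

section Sequences

variable {X : Type*} {Γ : SimpleGraph X}

/-- The Gromov products of corresponding members of two sequences go to infinity. -/
def CoConvergent (Γ : SimpleGraph X) (x y : ℕ → X) : Prop :=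
  ∀ o, Tendsto (fun i => gromovProduct Γ o (x i) (y i)) atTop atTop

/-- The Gromov products of the members of the sequence go to infinity. -/
def IsGromovSequence (Γ : SimpleGraph X) (x : ℕ → X) : Prop :=
  ∀ (o : X) (M : ℝ), ∃ n, ∀ i ≥ n, ∀ j ≥ n, M ≤ gromovProduct Γ o (x i) (x j)

theorem CoConvergent.of_base (hΓ : Γ.Connected) {x y : ℕ → X} (o : X)
    (h : Tendsto (fun i => gromovProduct Γ o (x i) (y i)) atTop atTop) : CoConvergent Γ x y := by
  intro o'
  refine tendsto_atTop_mono (f := fun i => gromovProduct Γ o (x i) (y i) + -(Γ.dist o o' : ℝ))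
    (fun i => ?_) (tendsto_atTop_add_const_right _ _ h)
  have := gromovProduct_le_add_dist_base hΓ o o' (x i) (y i)
  linarith

theorem IsGromovSequence.of_base (hΓ : Γ.Connected) {x : ℕ → X} (o : X)
    (h : ∀ M : ℝ, ∃ n, ∀ i ≥ n, ∀ j ≥ n, M ≤ gromovProduct Γ o (x i) (x j)) :
    IsGromovSequence Γ x := by
  intro o' M
  obtain ⟨n, hn⟩ := h (M + Γ.dist o o')
  refine ⟨n, fun i hi j hj => ?_⟩
  have h₁ := gromovProduct_le_add_dist_base hΓ o o' (x i) (x j)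
  have h₂ := hn i hi j hj
  linarith

theorem CoConvergent.symm {x y : ℕ → X} (h : CoConvergent Γ x y) : CoConvergent Γ y x := by
  intro o
  simp only [gromovProduct_comm _ (y _) (x _)]
  exact h o

theorem CoConvergent.trans {c : ℝ} (h4 : FourPoint Γ c) {x y z : ℕ → X}
    (hxy : CoConvergent Γ x y) (hyz : CoConvergent Γ y z) : CoConvergent Γ x z := by
  intro o
  refine tendsto_atTop_mono (fun i => h4 o (x i) (y i) (z i)) ?_
  simp only [sub_eq_add_neg]
  apply tendsto_atTop_add_const_right
  rw [tendsto_atTop]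
  intro b
  filter_upwards [(hxy o).eventually_ge_atTop b, (hyz o).eventually_ge_atTop b] with i h₁ h₂
  exact le_min h₁ h₂

theorem IsGromovSequence.coConvergent_self {x : ℕ → X} (h : IsGromovSequence Γ x) :
    CoConvergent Γ x x := by
  intro o
  rw [tendsto_atTop]
  intro M
  obtain ⟨n, hn⟩ := h o M
  filter_upwards [eventually_ge_atTop n] with i hi
  exact hn i hi i hi

theorem FourPoint.le_gromovProduct {c : ℝ} (h4 : FourPoint Γ c) {M : ℝ} {o x y z w : X}
    (hxy : M ≤ gromovProduct Γ o x y) (hyz : M ≤ gromovProduct Γ o y z)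
    (hzw : M ≤ gromovProduct Γ o z w) (hc : 0 ≤ c) : M - 2 * c ≤ gromovProduct Γ o x w := by
  have h₁ : M - c ≤ gromovProduct Γ o x z :=
    (sub_le_sub_right (le_min hxy hyz) c).trans (h4 o x y z)
  have h₂ := h4 o x z w
  have h₃ : M - c ≤ min (gromovProduct Γ o x z) (gromovProduct Γ o z w) :=
    le_min h₁ (by linarith)
  linarith

/-- Gromov sequences with large Gromov products between some late members are co-convergent. -/
theorem IsGromovSequence.coConvergent (hΓ : Γ.Connected) {c : ℝ} (h4 : FourPoint Γ c) (hc : 0 ≤ c)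
    {x y : ℕ → X} (hx : IsGromovSequence Γ x) (hy : IsGromovSequence Γ y) (o : X)
    (h : ∀ (M : ℝ) (n : ℕ), ∃ i ≥ n, ∃ j ≥ n, M ≤ gromovProduct Γ o (x i) (y j)) :
    CoConvergent Γ x y := by
  apply CoConvergent.of_base hΓ o
  rw [tendsto_atTop]
  intro M
  obtain ⟨m, hm⟩ := hx o (M + 2 * c)
  obtain ⟨n, hn⟩ := hy o (M + 2 * c)
  obtain ⟨i, hi, j, hj, hij⟩ := h (M + 2 * c) (max m n)
  filter_upwards [eventually_ge_atTop (max m n)] with k hk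
  have := h4.le_gromovProduct (hm k (le_of_max_le_left hk) i (le_of_max_le_left hi)) hij
    (hn j (le_of_max_le_right hj) k (le_of_max_le_right hk)) hc
  linarith

/-- Large Gromov products between two sequences are inherited by co-convergent sequences. -/
theorem eventually_le_gromovProduct {c : ℝ} (h4 : FourPoint Γ c) (hc : 0 ≤ c)
    {x y x' y' : ℕ → X} (hx : CoConvergent Γ x x') (hy : CoConvergent Γ y y') {o : X} {M : ℝ}
    (h : ∀ᶠ i in atTop, M ≤ gromovProduct Γ o (x i) (y i)) :
    ∀ᶠ i in atTop, M - 2 * c ≤ gromovProduct Γ o (x' i) (y' i) := by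
  filter_upwards [h, (hx.symm o).eventually_ge_atTop M, (hy o).eventually_ge_atTop M]
    with i h₁ h₂ h₃
  exact h4.le_gromovProduct h₂ h₁ h₃ hc

/-! ### Geodesic rays, boundary points and neighbourhoods in terms of Gromov products -/

theorem GeodesicRay.dist_vertex (r : GeodesicRay Γ) {i j : ℕ} (h : i ≤ j) :
    Γ.dist (r.vertex i) (r.vertex j) = j - i := by
  obtain ⟨k, rfl⟩ := Nat.exists_eq_add_of_le h
  rw [r.geodesic]; omega

theorem GeodesicRay.dist_zero (r : GeodesicRay Γ) (i : ℕ) :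
    Γ.dist (r.vertex 0) (r.vertex i) = i := by
  simpa using r.dist_vertex (Nat.zero_le i)

theorem GeodesicRay.mem_interval (r : GeodesicRay Γ) {i j k : ℕ} (hij : i ≤ j) (hjk : j ≤ k) :
    r.vertex j ∈ interval Γ (r.vertex i) (r.vertex k) := by
  simp only [interval, Set.mem_ofPred_eq]
  rw [r.dist_vertex hij, r.dist_vertex hjk, r.dist_vertex (hij.trans hjk)]
  omega

theorem GeodesicRay.adj_succ (r : GeodesicRay Γ) (i : ℕ) :
    Γ.Adj (r.vertex i) (r.vertex (i + 1)) := by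
  rw [← SimpleGraph.dist_eq_one_iff_adj, r.geodesic]

theorem GeodesicRay.gromovProduct_zero (r : GeodesicRay Γ) (i j : ℕ) :
    gromovProduct Γ (r.vertex 0) (r.vertex i) (r.vertex j) = min (i : ℝ) j := by
  rcases le_total i j with h | h
  · rw [gromovProduct_eq_dist_of_mem (r.mem_interval (Nat.zero_le i) h), r.dist_zero,
      min_eq_left (by exact_mod_cast h)]
  · rw [gromovProduct_comm, gromovProduct_eq_dist_of_mem (r.mem_interval (Nat.zero_le j) h),
      r.dist_zero, min_eq_right (by exact_mod_cast h)]

theorem GeodesicRay.isGromovSequence (hΓ : Γ.Connected) (r : GeodesicRay Γ) :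
    IsGromovSequence Γ r.vertex := by
  refine .of_base hΓ (r.vertex 0) fun M => ⟨⌈M⌉₊, fun i hi j hj => ?_⟩
  rw [r.gromovProduct_zero]
  have : M ≤ ⌈M⌉₊ := Nat.le_ceil M
  exact le_min (this.trans (by exact_mod_cast hi)) (this.trans (by exact_mod_cast hj))

theorem GeodesicRay.Equivalent.coConvergent (hΓ : Γ.Connected) {c : ℝ} (h4 : FourPoint Γ c)
    (hc : 0 ≤ c) {r s : GeodesicRay Γ} (h : r.Equivalent s) :
    CoConvergent Γ r.vertex s.vertex := by
  obtain ⟨M, h, -⟩ := h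
  refine (r.isGromovSequence hΓ).coConvergent hΓ h4 hc (s.isGromovSequence hΓ) (r.vertex 0)
    fun B n => ?_
  -- Since `j ≥ i - M - Γ.dist (r.vertex 0) (s.vertex 0)`, this choice makes `j` large along with
  -- `i`; the Gromov product is at least `i - M`.
  obtain ⟨i, ⟨j, hij⟩, hi⟩ :=
    h.exists_gt (⌈B⌉₊ + n + M + Γ.dist (r.vertex 0) (s.vertex 0))
  have h₁ := hΓ.dist_triangle (u := r.vertex 0) (v := s.vertex 0) (w := s.vertex j)
  have h₂ := hΓ.dist_triangle (u := r.vertex 0) (v := s.vertex j) (w := r.vertex i)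
  rw [s.dist_zero] at h₁
  rw [Γ.dist_comm (u := s.vertex j), r.dist_zero] at h₂
  refine ⟨i, by omega, j, by omega, ?_⟩
  have h₃ : (⌈B⌉₊ : ℝ) + M + n ≤ i := by exact_mod_cast (by omega)
  have h₄ : (i : ℝ) ≤ Γ.dist (r.vertex 0) (s.vertex j) + Γ.dist (r.vertex i) (s.vertex j) := by
    exact_mod_cast h₂
  have h₅ : (Γ.dist (r.vertex i) (s.vertex j) : ℝ) ≤ M := by exact_mod_cast hij
  have h₆ : B ≤ ⌈B⌉₊ := Nat.le_ceil B
  have h₇ : (0 : ℝ) ≤ n := by positivity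
  simp only [gromovProduct, r.dist_zero]
  linarith

/-- Far out the two rays have a product of at least `a`; the chain `r a`, `r i`, `s i`, `s a` brings
this back to index `a`, with loss `d + 2c` where `d` is the distance of the starting vertices. -/
theorem CoConvergent.dist_le (hΓ : Γ.Connected) {c : ℝ} (h4 : FourPoint Γ c) (hc : 0 ≤ c)
    {r s : GeodesicRay Γ} (h : CoConvergent Γ r.vertex s.vertex) (a : ℕ) :
    (Γ.dist (r.vertex a) (s.vertex a) : ℝ) ≤
      3 * Γ.dist (r.vertex 0) (s.vertex 0) + 4 * c := by
  obtain ⟨i, hi, hai⟩ := (((h (r.vertex 0)).eventually_ge_atTop (a : ℝ)).and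
    (eventually_ge_atTop a)).exists
  set d : ℝ := ((Γ.dist (r.vertex 0) (s.vertex 0) : ℕ) : ℝ)
  have hd : 0 ≤ d := Nat.cast_nonneg _
  have hai' : (a : ℝ) ≤ i := by exact_mod_cast hai
  have h₁ : a - d ≤ gromovProduct Γ (r.vertex 0) (r.vertex a) (r.vertex i) := by
    rw [r.gromovProduct_zero, min_eq_left hai']; linarith
  have h₂ : a - d ≤ gromovProduct Γ (r.vertex 0) (s.vertex i) (s.vertex a) := by
    have := gromovProduct_le_add_dist_base hΓ (s.vertex 0) (r.vertex 0) (s.vertex i) (s.vertex a)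
    rw [s.gromovProduct_zero, min_eq_right hai', Γ.dist_comm] at this
    linarith
  have h₃ := h4.le_gromovProduct h₁ (by linarith) h₂ hc
  have h₄ := dist_triangle_cast hΓ (r.vertex 0) (s.vertex 0) (s.vertex a)
  rw [s.dist_zero] at h₄
  rw [dist_le_of_gromovProduct (o := r.vertex 0), r.dist_zero]
  linarith

theorem CoConvergent.equivalent (hΓ : Γ.Connected) {c : ℝ} (h4 : FourPoint Γ c) (hc : 0 ≤ c)
    {r s : GeodesicRay Γ} (h : CoConvergent Γ r.vertex s.vertex) : r.Equivalent s := by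
  have key := fun a => (h.dist_le hΓ h4 hc a).trans (Nat.le_ceil _)
  refine ⟨⌈3 * (Γ.dist (r.vertex 0) (s.vertex 0) : ℝ) + 4 * c⌉₊, ?_, ?_⟩
  · convert Set.infinite_univ (α := ℕ)
    exact Set.eq_univ_of_forall fun a => ⟨a, by exact_mod_cast key a⟩
  · convert Set.infinite_univ (α := ℕ)
    refine Set.eq_univ_of_forall fun a => ⟨a, ?_⟩
    rw [Γ.dist_comm]
    exact_mod_cast key a

/-- Equality in the quotient is the equivalence relation generated by `Equivalent`. Co-convergence
is transitive by the four-point inequality, contains `Equivalent` and implies it, so all three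
agree. -/
theorem GeodesicRay.point_eq_iff (hΓ : Γ.Connected) {c : ℝ} (h4 : FourPoint Γ c) (hc : 0 ≤ c)
    {r s : GeodesicRay Γ} : r.point = s.point ↔ CoConvergent Γ r.vertex s.vertex := by
  constructor
  · intro h
    replace h := Quot.eqvGen_exact h
    induction h with
    | rel r s h => exact h.coConvergent hΓ h4 hc
    | refl r => exact (r.isGromovSequence hΓ).coConvergent_self
    | symm r s _ ih => exact ih.symm
    | trans r s t _ _ ih₁ ih₂ => exact ih₁.trans h4 ih₂
  · exact fun h => Quot.sound (h.equivalent hΓ h4 hc)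

theorem exists_point_eq (ξ : Boundary Γ) : ∃ r : GeodesicRay Γ, r.point = ξ := Quot.exists_rep ξ

/-- The distance of `o` to the shortest paths from `x i` to `y i` is the Gromov product up to a
constant; co-convergence also makes the choice of the ray in the class immaterial. -/
theorem convergesTo_iff (hΓ : Γ.Connected) {δ : ℕ} (hδ : ThinIntervals Γ δ) {x : ℕ → X}
    {s : GeodesicRay Γ} : ConvergesTo Γ x s.point ↔ CoConvergent Γ x s.vertex := by
  constructor
  · rintro ⟨y, hy, h⟩
    rw [GeodesicRay.point_eq_iff hΓ (hδ.fourPoint hΓ) (by positivity)] at hy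
    refine CoConvergent.trans (hδ.fourPoint hΓ) (fun o => ?_) hy
    obtain ⟨n, hn, hd⟩ := h o
    refine tendsto_atTop_mono (f := fun i => (n i : ℝ) + -(2 * δ + 1)) (fun i => ?_)
      (tendsto_atTop_add_const_right _ _ (tendsto_natCast_atTop_atTop.comp hn))
    obtain ⟨w, hw, hwd⟩ := hδ.exists_dist_le hΓ o (x i) (y.vertex i)
    obtain ⟨P, hP, hwP⟩ := exists_isShortest_of_mem_interval hΓ hw
    have : (n i : ℝ) ≤ Γ.dist o w := by exact_mod_cast hd i P hP w hwP
    linarith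
  · intro h
    refine ⟨s, rfl, fun o => ⟨fun i => ⌊gromovProduct Γ o (x i) (s.vertex i)⌋₊,
      tendsto_nat_floor_atTop.comp (h o), fun i P hP a ha => ?_⟩⟩
    have := gromovProduct_le_dist_of_mem hΓ (o := o) (hP.mem_interval ha)
    exact Nat.floor_le_of_le this

theorem Near.base_change (hΓ : Γ.Connected) {o o' : X} {m n : ℕ} (hmn : m + Γ.dist o o' ≤ n)
    {ξ η : Boundary Γ} (h : Near Γ o n ξ η) : Near Γ o' m ξ η := by
  obtain ⟨r, s, hr, hs, N, hN⟩ := h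
  refine ⟨r, s, hr, hs, N, fun i hi j hj => ?_⟩
  have h₁ := hN i hi j hj
  have h₂ := gromovProduct_le_add_dist_base hΓ o o' (r.vertex i) (s.vertex j)
  have h₃ : (m : ℝ) + Γ.dist o o' ≤ n := by exact_mod_cast hmn
  linarith

theorem Near.eventually_le (hΓ : Γ.Connected) {c : ℝ} (h4 : FourPoint Γ c) (hc : 0 ≤ c)
    {o : X} {n : ℕ} {r s : GeodesicRay Γ} (h : Near Γ o n r.point s.point) {x y : ℕ → X}
    (hx : CoConvergent Γ x r.vertex) (hy : CoConvergent Γ y s.vertex) :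
    ∀ᶠ i in atTop, n - 2 * c ≤ gromovProduct Γ o (x i) (y i) := by
  obtain ⟨r', s', hr, hs, N, hN⟩ := h
  rw [GeodesicRay.point_eq_iff hΓ h4 hc] at hr hs
  refine eventually_le_gromovProduct h4 hc (hr.trans h4 hx.symm) (hs.trans h4 hy.symm) ?_
  filter_upwards [eventually_ge_atTop N] with i hi
  exact hN i hi i hi

/-- Of the loss `4 * c`, one half comes from replacing the sequences by the rays, the other from
passing from equal indices to arbitrary pairs of late indices. -/
theorem near_of_eventually_le (hΓ : Γ.Connected) {c : ℝ} (h4 : FourPoint Γ c) (hc : 0 ≤ c)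
    {o : X} {n : ℕ} {r s : GeodesicRay Γ} {x y : ℕ → X}
    (hx : CoConvergent Γ x r.vertex) (hy : CoConvergent Γ y s.vertex)
    (h : ∀ᶠ i in atTop, n + 4 * c ≤ gromovProduct Γ o (x i) (y i)) :
    Near Γ o n r.point s.point := by
  obtain ⟨N, hN⟩ := (eventually_le_gromovProduct h4 hc hx hy h).exists_forall_of_atTop
  obtain ⟨N₁, h₁⟩ := r.isGromovSequence hΓ o (n + 2 * c)
  obtain ⟨N₂, h₂⟩ := s.isGromovSequence hΓ o (n + 2 * c)
  refine ⟨r, s, rfl, rfl, max N₁ N₂, fun i hi j hj => ?_⟩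
  set k := max N (max N₁ N₂)
  have h₃ : n + 2 * c ≤ gromovProduct Γ o (r.vertex k) (s.vertex k) := by
    have := hN k (le_max_left _ _); linarith
  have := h4.le_gromovProduct
    (h₁ i ((le_max_left _ _).trans hi) k ((le_max_left _ _).trans (le_max_right _ _))) h₃
    (h₂ k ((le_max_right _ _).trans (le_max_right _ _)) j ((le_max_right _ _).trans hj)) hc
  linarith

end Sequences

/-! ### Guessing geodesics -/

section Guessing

variable {X : Type*} {Γ : SimpleGraph X}

/-- A family of connected sets, one for every pair of vertices, that looks like the family of
geodesics in a hyperbolic graph. -/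
structure GuessedGeodesics (Γ : SimpleGraph X) (L : X → X → Set X) (h : ℕ) : Prop where
  exists_walk : ∀ x y, ∃ P : Γ.Walk x y, ∀ a ∈ P.support, a ∈ L x y
  thin : ∀ x y z w, w ∈ L x y → ∃ w', (w' ∈ L x z ∨ w' ∈ L z y) ∧ Γ.dist w w' ≤ h
  small : ∀ x y w, Γ.dist x y ≤ 1 → w ∈ L x y → Γ.dist w x ≤ h

variable {L : X → X → Set X} {h : ℕ}

/-- Bisection: each halving of the path costs one application of `thin`, that is `h`, and a piece of
length at most one costs a last `h`. The path need not be geodesic; the bound is logarithmic in its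
length. -/
theorem GuessedGeodesics.exists_dist_le_mul (hΓ : Γ.Connected) (hL : GuessedGeodesics Γ L h)
    {γ : ℕ → X} {n : ℕ} (hγ : ∀ i < n, Γ.dist (γ i) (γ (i + 1)) ≤ 1) (k : ℕ) :
    ∀ a b, a ≤ b → b ≤ n → b - a ≤ 2 ^ k → ∀ w ∈ L (γ a) (γ b),
      ∃ i, a ≤ i ∧ i ≤ b ∧ Γ.dist w (γ i) ≤ (k + 1) * h := by
  induction k with
  | zero =>
    intro a b hab hb h₁ w hw
    refine ⟨a, le_rfl, hab, ?_⟩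
    have h₂ := dist_le_of_forall_succ hΓ hγ hab hb
    simpa using hL.small _ _ w (h₂.trans (by simpa using h₁)) hw
  | succ k ih =>
    intro a b hab hb h₁ w hw
    rw [pow_succ] at h₁
    obtain ⟨w', hw', hd⟩ := hL.thin _ _ (γ ((a + b) / 2)) w hw
    have key : ∃ i, a ≤ i ∧ i ≤ b ∧ Γ.dist w' (γ i) ≤ (k + 1) * h := by
      rcases hw' with hw' | hw'
      · obtain ⟨i, h₂, h₃, h₄⟩ := ih a ((a + b) / 2) (by omega) (by omega) (by omega) w' hw'
        exact ⟨i, h₂, by omega, h₄⟩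
      · obtain ⟨i, h₂, h₃, h₄⟩ := ih ((a + b) / 2) b (by omega) (by omega) (by omega) w' hw'
        exact ⟨i, by omega, h₃, h₄⟩
    obtain ⟨i, h₂, h₃, h₄⟩ := key
    refine ⟨i, h₂, h₃, ?_⟩
    have := hΓ.dist_triangle (u := w) (v := w') (w := γ i)
    have : (k + 1 + 1) * h = (k + 1) * h + h := by ring
    omega

/-- A number bounded by a multiple of its own logarithm is bounded. With `k = Nat.clog 2 (6 * t)`
one has `2 ^ k < 12 * t`, which contradicts `12 * (3 + k) * h < 2 ^ k` for large `k`. -/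
theorem exists_bound_of_le_clog_mul (h : ℕ) :
    ∃ K, ∀ t, t ≤ (3 + Nat.clog 2 (6 * t)) * h → t ≤ K := by
  have : ∀ᶠ k : ℕ in atTop, 12 * (3 + k) * h < 2 ^ k := by
    have h₁ : Tendsto (fun k : ℕ => (k : ℝ) ^ 1 / 2 ^ k) atTop (nhds 0) :=
      tendsto_pow_const_div_const_pow_of_one_lt 1 (by norm_num)
    have h₂ : Tendsto (fun k : ℕ => (k : ℝ) ^ 0 / 2 ^ k) atTop (nhds 0) :=
      tendsto_pow_const_div_const_pow_of_one_lt 0 (by norm_num)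
    have h₃ := ((h₂.const_mul (36 * (h : ℝ))).add (h₁.const_mul (12 * (h : ℝ))))
    simp only [mul_zero, add_zero] at h₃
    filter_upwards [h₃.eventually_lt_const one_pos] with k hk
    have hp : (0 : ℝ) < 2 ^ k := by positivity
    rw [← mul_div_assoc, ← mul_div_assoc, ← add_div, div_lt_one hp] at hk
    have : ((12 * (3 + k) * h : ℕ) : ℝ) < ((2 ^ k : ℕ) : ℝ) := by
      push_cast; linarith
    exact_mod_cast this
  obtain ⟨k₀, hk₀⟩ := this.exists_forall_of_atTop
  refine ⟨(3 + k₀) * h, fun t ht => ?_⟩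
  by_contra! hlt
  have hk : k₀ ≤ Nat.clog 2 (6 * t) := by
    by_contra! hk
    exact absurd (ht.trans (Nat.mul_le_mul_right h (by omega : 3 + Nat.clog 2 (6 * t) ≤ 3 + k₀)))
      (by omega)
  have h₁ := hk₀ _ hk
  have h₂ : 2 ^ (Nat.clog 2 (6 * t)).pred < 6 * t :=
    Nat.pow_pred_clog_lt_self (by norm_num) (by omega)
  have h₃ : 2 ^ (Nat.clog 2 (6 * t)) ≤ 2 * 2 ^ (Nat.clog 2 (6 * t)).pred := by
    rw [← pow_succ']
    exact Nat.pow_le_pow_right (by norm_num) (by rw [Nat.pred_eq_sub_one]; omega)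
  have h₄ : 12 * (3 + Nat.clog 2 (6 * t)) * h = 12 * ((3 + Nat.clog 2 (6 * t)) * h) := by ring
  omega

/-- The guessed geodesics are uniformly close to the geodesics. -/
theorem GuessedGeodesics.exists_bound (hΓ : Γ.Connected) (hL : GuessedGeodesics Γ L h) :
    ∃ K, ∀ (γ : ℕ → X) (n : ℕ), IsGeodesicUpTo Γ γ n → ∀ w ∈ L (γ 0) (γ n),
      ∃ i ≤ n, Γ.dist w (γ i) ≤ K := by
  obtain ⟨K₀, hK₀⟩ := exists_bound_of_le_clog_mul h
  refine ⟨K₀ + 3 * h, fun γ n hγ w hw => ?_⟩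
  -- `B t` says that all guessed geodesics over geodesics of length at most `n` are `t`-close
  let B : ℕ → Prop := fun t => ∀ (γ : ℕ → X) (m : ℕ), IsGeodesicUpTo Γ γ m → ∀ a b, a ≤ b →
    b ≤ m → b - a ≤ n → ∀ w ∈ L (γ a) (γ b), ∃ i, a ≤ i ∧ i ≤ b ∧ Γ.dist w (γ i) ≤ t
  have step : ∀ {γ : ℕ → X} {m : ℕ}, IsGeodesicUpTo Γ γ m →
      ∀ i < m, Γ.dist (γ i) (γ (i + 1)) ≤ 1 := by
    intro γ m hγ i hi
    rw [hγ i (i + 1) (by omega) hi]; omega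
  have hB : ∃ t, B t := by
    refine ⟨(n + 1) * h, fun γ m hγ a b hab hb hn w hw => ?_⟩
    exact hL.exists_dist_le_mul hΓ (step hγ) n a b hab hb
      (hn.trans Nat.lt_two_pow_self.le) w hw
  classical
  -- The bisection bound shows that some `t` works, but one depending on `n`. The least one turns
  -- out to be bounded independently of `n`.
  set t := Nat.find hB with ht
  have hBt : B t := Nat.find_spec hB
  suffices htK : t ≤ K₀ + 3 * h by
    obtain ⟨i, -, hi, hd⟩ := hBt γ n hγ 0 n (Nat.zero_le n) le_rfl (by omega) w hw
    exact ⟨i, hi, hd.trans htK⟩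
  by_contra! hlt
  have hnB : ¬ B (t - 1) := Nat.find_min hB (by omega)
  simp only [B, not_forall] at hnB
  obtain ⟨γ, m, hγ, a, b, hab, hb, hn, w, hw, hfar⟩ := hnB
  push Not at hfar
  obtain ⟨i, hai, hib, hd⟩ := hBt γ m hγ a b hab hb hn w hw
  -- By minimality `w` has distance at least `t` to the whole segment, yet at most `t` to `γ i`. Cut
  -- out a window of radius `3 * t` around `i`. If `w` were `h`-close to the guessed geodesic before
  -- the window, it would be within `t + h` of some `γ j` with `i - j ≥ 3 * t`, forcing `t ≤ h`; the
  -- part after the window is similar.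
  set x := max a (i - 3 * t) with hx
  set y := min b (i + 3 * t) with hy
  obtain ⟨w₁, hw₁, hd₁⟩ := hL.thin _ _ (γ x) w hw
  rcases hw₁ with hw₁ | hw₁
  · by_cases hxa : x = a
    · rw [hxa] at hw₁
      have h₁ := hL.small _ _ w₁ (by simp) hw₁
      have h₂ := hΓ.dist_triangle (u := w) (v := w₁) (w := γ a)
      have h₃ := hfar a le_rfl hab
      omega
    · obtain ⟨j, h₁, h₂, h₃⟩ := hBt γ m hγ a x (by omega) (by omega) (by omega) w₁ hw₁
      have h₄ := hΓ.dist_triangle (u := w) (v := w₁) (w := γ j)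
      have h₅ := hΓ.dist_triangle (u := γ j) (v := w) (w := γ i)
      rw [hγ j i (by omega) (by omega), Γ.dist_comm (u := γ j)] at h₅
      omega
  obtain ⟨w₂, hw₂, hd₂⟩ := hL.thin _ _ (γ y) w₁ hw₁
  have h₀ := hΓ.dist_triangle (u := w) (v := w₁) (w := w₂)
  rcases hw₂ with hw₂ | hw₂
  -- Inside the window the length is at most `6 * t`, so the logarithmic bound applies and gives `t
  -- ≤ (3 + Nat.clog 2 (6 * t)) * h`.
  · obtain ⟨j, h₁, h₂, h₃⟩ := hL.exists_dist_le_mul hΓ (step hγ) (Nat.clog 2 (6 * t)) x y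
      (by omega) (by omega) ((by omega : y - x ≤ 6 * t).trans (Nat.le_pow_clog (by norm_num) _))
      w₂ hw₂
    have h₄ := hΓ.dist_triangle (u := w) (v := w₂) (w := γ j)
    have h₅ := hfar j (by omega) (by omega)
    have h₆ : (3 + Nat.clog 2 (6 * t)) * h = (Nat.clog 2 (6 * t) + 1) * h + 2 * h := by ring
    have := hK₀ t (by omega)
    omega
  · by_cases hyb : y = b
    · rw [hyb] at hw₂
      have h₁ := hL.small _ _ w₂ (by simp) hw₂
      have h₂ := hΓ.dist_triangle (u := w) (v := w₂) (w := γ b)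
      have h₃ := hfar b hab le_rfl
      omega
    · obtain ⟨j, h₁, h₂, h₃⟩ := hBt γ m hγ y b (by omega) (by omega) (by omega) w₂ hw₂
      have h₄ := hΓ.dist_triangle (u := w) (v := w₂) (w := γ j)
      have h₅ := hΓ.dist_triangle (u := γ i) (v := w) (w := γ j)
      rw [hγ i j (by omega) (by omega), Γ.dist_comm (u := γ i)] at h₅
      omega

/-- The second half follows from the first by connectedness. A walk inside `L x y` passes from
vertices close to the initial segment of the geodesic up to `v` to one close only to the rest; at
this edge it is near two vertices of the geodesic on different sides of `v`, hence near `v`. -/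
theorem GuessedGeodesics.exists_close (hΓ : Γ.Connected) (hL : GuessedGeodesics Γ L h) :
    ∃ K, (∀ x y, ∀ w ∈ L x y, ∃ v ∈ interval Γ x y, Γ.dist w v ≤ K) ∧
      ∀ x y, ∀ v ∈ interval Γ x y, ∃ w ∈ L x y, Γ.dist v w ≤ K := by
  obtain ⟨K, hK⟩ := hL.exists_bound hΓ
  refine ⟨3 * K + 1, fun x y w hw => ?_, fun x y v hv => ?_⟩
  · obtain ⟨γ, h0, hn, hγ⟩ := exists_geodesic hΓ x y
    obtain ⟨i, hi, hd⟩ := hK γ _ hγ w (by rwa [h0, hn])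
    have := hγ.mem_interval (Nat.zero_le i) hi le_rfl
    rw [h0, hn] at this
    exact ⟨γ i, this, by omega⟩
  · obtain ⟨Q, hQ, hvQ⟩ := exists_isShortest_of_mem_interval hΓ hv
    obtain ⟨i, rfl, hi⟩ := SimpleGraph.Walk.mem_support_iff_exists_getVert.1 hvQ
    have hγ := isGeodesicUpTo_getVert hΓ hQ
    have hK := hK _ _ hγ
    rw [Q.getVert_zero, Q.getVert_length] at hK
    obtain ⟨P, hP⟩ := hL.exists_walk x y
    by_cases hy : ∃ j ≤ i, Γ.dist y (Q.getVert j) ≤ K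
    · obtain ⟨j, hj, hd⟩ := hy
      refine ⟨y, hP y (by simp), ?_⟩
      have h₁ := hγ j _ (hj.trans hi) le_rfl
      have h₂ := hγ i _ hi le_rfl
      rw [Q.getVert_length] at h₁ h₂
      rw [Γ.dist_comm] at hd
      omega
    · obtain ⟨d, hd, ⟨j, hj, hjd⟩, h₂⟩ := P.exists_boundary_dart
        {w | ∃ j ≤ i, Γ.dist w (Q.getVert j) ≤ K} ⟨0, Nat.zero_le _, by simp⟩ hy
      have hfst := hP _ (P.dart_fst_mem_support_of_mem_darts hd)
      have hsnd := hP _ (P.dart_snd_mem_support_of_mem_darts hd)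
      refine ⟨d.fst, hfst, ?_⟩
      obtain ⟨k, hk, hkd⟩ := hK _ hsnd
      have hik : i < k := by
        by_contra! hle
        exact h₂ ⟨k, hle, hkd⟩
      have t₁ := hΓ.dist_triangle (u := Q.getVert j) (v := d.fst) (w := Q.getVert k)
      have t₂ := hΓ.dist_triangle (u := d.fst) (v := d.snd) (w := Q.getVert k)
      have t₃ := SimpleGraph.dist_eq_one_iff_adj.2 d.adj
      have t₄ := hΓ.dist_triangle (u := Q.getVert i) (v := Q.getVert j) (w := d.fst)
      rw [hγ j k (by omega) hk] at t₁
      rw [Γ.dist_comm (u := Q.getVert i) (v := Q.getVert j), hγ j i hj hi] at t₄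
      rw [Γ.dist_comm (v := Q.getVert j)] at hjd
      omega

theorem GuessedGeodesics.thinIntervals (hΓ : Γ.Connected) (hL : GuessedGeodesics Γ L h) :
    ∃ δ, ThinIntervals Γ δ := by
  obtain ⟨K, h₁, h₂⟩ := hL.exists_close hΓ
  refine ⟨K + h + K, fun x y z v hv => ?_⟩
  obtain ⟨w, hw, d₁⟩ := h₂ x y v hv
  obtain ⟨w', hw', d₂⟩ := hL.thin x y z w hw
  have t₁ := hΓ.dist_triangle (u := v) (v := w) (w := w')
  rcases hw' with hw' | hw'
  · obtain ⟨v', hv', d₃⟩ := h₁ _ _ w' hw'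
    have t₂ := hΓ.dist_triangle (u := v) (v := w') (w := v')
    exact ⟨v', Or.inl hv', by omega⟩
  · obtain ⟨v', hv', d₃⟩ := h₁ _ _ w' hw'
    have t₂ := hΓ.dist_triangle (u := v) (v := w') (w := v')
    exact ⟨v', Or.inr hv', by omega⟩

end Guessing

/-! ### Rays as limits of shortest paths -/

section Konig

variable {X : Type*} {Γ : SimpleGraph X}

/-- A sequence of targets such that the shortest paths to infinitely many of them share longer and
longer initial segments yields a geodesic ray. -/
theorem exists_ray_of_infinite (hΓ : Γ.Connected) (o : X) (y : ℕ → X)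
    (h : ∀ v, {n | v ∈ interval Γ o (y n)}.Infinite →
      ∃ v', v' ≠ v ∧ v ∈ interval Γ o v' ∧ {n | v' ∈ interval Γ o (y n)}.Infinite) :
    ∃ s : GeodesicRay Γ, s.vertex 0 = o ∧
      ∀ k, {n | s.vertex k ∈ interval Γ o (y n)}.Infinite := by
  have next : ∀ v : {v // {n | v ∈ interval Γ o (y n)}.Infinite},
      ∃ v' : {v // {n | v ∈ interval Γ o (y n)}.Infinite},
        Γ.Adj v.1 v'.1 ∧ v.1 ∈ interval Γ o v'.1 := by
    rintro ⟨v, hv⟩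
    obtain ⟨v', hne, hvv', hinf⟩ := h v hv
    -- The vertex `v'` may be far from `v`; the first vertex on a shortest path towards it still
    -- lies on shortest paths to infinitely many targets.
    obtain ⟨z, hz, hzI⟩ := exists_adj_mem_interval hΓ hne.symm
    obtain ⟨h₁, h₂⟩ := mem_interval_trans hΓ hvv' hzI
    exact ⟨⟨z, hinf.mono fun n hn => mem_interval_of_mem_of_mem hΓ hn h₁⟩, hz, h₂⟩
  choose f hf using next
  have ho : {n | o ∈ interval Γ o (y n)}.Infinite := by
    convert Set.infinite_univ (α := ℕ)
    exact Set.eq_univ_of_forall fun n => left_mem_interval _ _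
  let w : ℕ → {v // {n | v ∈ interval Γ o (y n)}.Infinite} := fun k => f^[k] ⟨o, ho⟩
  have hw : ∀ k, w (k + 1) = f (w k) := fun k => Function.iterate_succ_apply' f k _
  have hadj : ∀ k, Γ.dist (w k).1 (w (k + 1)).1 = 1 := fun k => by
    rw [hw, SimpleGraph.dist_eq_one_iff_adj]; exact (hf _).1
  have hdist : ∀ k, Γ.dist o (w k).1 = k := by
    intro k
    induction k with
    | zero => simp [w]
    | succ k ih =>
      have h₁ := (hf (w k)).2
      rw [← hw] at h₁
      have h₂ : Γ.dist o (w k).1 + Γ.dist (w k).1 (w (k + 1)).1 = Γ.dist o (w (k + 1)).1 := h₁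
      rw [← h₂, ih, hadj]
  refine ⟨⟨fun k => (w k).1, fun i k => ?_⟩, rfl, fun k => (w k).2⟩
  have h₁ := isGeodesicUpTo_of_dist hΓ (γ := fun k => (w k).1) (n := i + k)
    (fun j _ => (hadj j).le) (hdist (i + k)).ge
  exact (h₁ i (i + k) (by omega) le_rfl).trans (by omega)

theorem exists_infinite_of_finite {β : Type*} {N : Set ℕ} (hN : N.Infinite) {F : Set β}
    (hF : F.Finite) {R : ℕ → β → Prop} (h : ∀ᶠ n in atTop, n ∈ N → ∃ b ∈ F, R n b) :
    ∃ b ∈ F, {n | n ∈ N ∧ R n b}.Infinite := by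
  by_contra! hcon
  obtain ⟨n₀, hn₀⟩ := h.exists_forall_of_atTop
  refine hN (((hF.biUnion hcon).union (Set.finite_lt_nat n₀)).subset fun n hn => ?_)
  by_cases hlt : n < n₀
  · exact Or.inr hlt
  · obtain ⟨b, hb, hR⟩ := hn₀ n (by omega) hn
    exact Or.inl (Set.mem_biUnion hb ⟨hn, hR⟩)

/-- A ray all of whose vertices lie on shortest paths to infinitely many members of a Gromov
sequence is a limit of that sequence. -/
theorem coConvergent_of_infinite (hΓ : Γ.Connected) {c : ℝ} (h4 : FourPoint Γ c) (hc : 0 ≤ c)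
    {y : ℕ → X} (hy : IsGromovSequence Γ y) {s : GeodesicRay Γ}
    (h : ∀ k, {n | s.vertex k ∈ interval Γ (s.vertex 0) (y n)}.Infinite) :
    CoConvergent Γ y s.vertex := by
  refine ((s.isGromovSequence hΓ).coConvergent hΓ h4 hc hy (s.vertex 0) fun M n => ?_).symm
  obtain ⟨j, hj, hnj⟩ := (h (max ⌈M⌉₊ n)).exists_gt n
  refine ⟨max ⌈M⌉₊ n, le_max_right _ _, j, hnj.le, ?_⟩
  rw [gromovProduct_eq_dist_of_mem hj, s.dist_zero]
  exact (Nat.le_ceil M).trans (by exact_mod_cast le_max_left _ _)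

theorem finite_setOf_dist_le (hΓ : Γ.Connected) (hfin : IsLocallyFinite Γ) (o : X) (n : ℕ) :
    {x | Γ.dist o x ≤ n}.Finite := by
  induction n with
  | zero =>
    refine (Set.finite_singleton o).subset fun x hx => ?_
    have : Γ.dist o x = 0 := Nat.le_zero.1 hx
    exact (hΓ.dist_eq_zero_iff.1 this).symm
  | succ n ih =>
    refine (ih.union (ih.biUnion fun x _ => hfin x)).subset fun x hx => ?_
    by_cases hxo : x = o
    · left; simp [hxo]
    · obtain ⟨z, hz, hzI⟩ := exists_adj_mem_interval hΓ hxo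
      right
      refine Set.mem_biUnion (x := z) ?_ hz.symm
      have h₁ : Γ.dist x z + Γ.dist z o = Γ.dist x o := hzI
      have h₂ := SimpleGraph.dist_eq_one_iff_adj.2 hz
      have h₃ : Γ.dist o x ≤ n + 1 := hx
      rw [Γ.dist_comm] at h₃
      simp only [Set.mem_ofPred_eq]
      rw [Γ.dist_comm]
      omega

/-- In a locally finite graph, infinitely many distinct targets yield a ray. -/
theorem exists_ray_of_locallyFinite (hΓ : Γ.Connected) (hfin : IsLocallyFinite Γ) (o : X)
    {y : ℕ → X} (hy : Function.Injective y) :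
    ∃ s : GeodesicRay Γ, s.vertex 0 = o ∧
      ∀ k, {n | s.vertex k ∈ interval Γ o (y n)}.Infinite := by
  refine exists_ray_of_infinite hΓ o y fun v hv => ?_
  have key : ∀ᶠ n in atTop, n ∈ {n | v ∈ interval Γ o (y n)} → ∃ z ∈ Γ.neighborSet v,
      z ∈ interval Γ v (y n) := by
    have : {n | y n = v}.Finite :=
      (Set.finite_singleton v).preimage hy.injOn
    filter_upwards [Nat.cofinite_eq_atTop ▸ this.compl_mem_cofinite] with n hn _
    obtain ⟨z, hz, hzI⟩ := exists_adj_mem_interval hΓ (Ne.symm hn)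
    exact ⟨z, hz, hzI⟩
  obtain ⟨z, hz, hinf⟩ := exists_infinite_of_finite hv (hfin v) key
  refine ⟨z, (show Γ.Adj v z from hz).ne', ?_, ?_⟩
  · obtain ⟨n, hn, hzn⟩ := hinf.nonempty
    exact (mem_interval_trans hΓ hn hzn).2
  · exact hinf.mono fun n hn => (mem_interval_trans hΓ hn.1 hn.2).1

end Konig

/-! ### Directions in trees -/

section Tree

variable {W : Type*} {T : SimpleGraph W}

open Classical in
/-- The neighbour of `t` on the way from `t` to `s`, and `t` itself if `s = t`. -/
noncomputable def toward (T : SimpleGraph W) (t s : W) : W :=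
  if h : ∃ z, T.Adj t z ∧ z ∈ interval T t s ∧ t ≠ s then h.choose else t

theorem toward_self (t : W) : toward T t t = t := by
  simp [toward]

theorem toward_spec (hT : T.IsTree) {t s : W} (h : s ≠ t) :
    T.Adj t (toward T t s) ∧ toward T t s ∈ interval T t s := by
  have hex : ∃ z, T.Adj t z ∧ z ∈ interval T t s ∧ t ≠ s := by
    obtain ⟨z, h₁, h₂⟩ := exists_adj_mem_interval hT.1 h.symm
    exact ⟨z, h₁, h₂, h.symm⟩
  rw [toward, dif_pos hex]
  exact ⟨hex.choose_spec.1, hex.choose_spec.2.1⟩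

theorem toward_eq_self_iff (hT : T.IsTree) {t s : W} : toward T t s = t ↔ s = t := by
  constructor
  · intro h
    by_contra hne
    exact (toward_spec hT hne).1.ne h.symm
  · rintro rfl
    exact toward_self _

theorem dist_toward (hT : T.IsTree) {t s : W} (h : s ≠ t) :
    T.dist (toward T t s) s + 1 = T.dist t s := by
  obtain ⟨h₁, h₂⟩ := toward_spec hT h
  have h₃ : T.dist t (toward T t s) + T.dist (toward T t s) s = T.dist t s := h₂
  rw [SimpleGraph.dist_eq_one_iff_adj.2 h₁] at h₃
  omega

theorem isShortest_of_isPath (hT : T.IsTree) {x y : W} {P : T.Walk x y} (hP : P.IsPath) :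
    IsShortest P := by
  obtain ⟨Q, hQ, hl⟩ := hT.1.exists_path_of_dist x y
  rw [(hT.existsUnique_path x y).unique hP hQ]
  exact hl

/-- If the path from `s` to `s'` avoided `t`, one could walk from `t` to `s` and on to `s'` without
returning to `t`; the resulting path to `s'` would start with the wrong edge. -/
theorem mem_interval_of_toward_ne (hT : T.IsTree) {t s s' : W}
    (h : toward T t s ≠ toward T t s') : t ∈ interval T s s' := by
  classical
  by_contra hnot
  have hs : s ≠ t := by
    rintro rfl; exact hnot (left_mem_interval _ _)
  have hs' : s' ≠ t := by
    rintro rfl; exact hnot (right_mem_interval _ _)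
  obtain ⟨R, hR, -⟩ := hT.existsUnique_path s s'
  have htR : t ∉ R.support := fun ht =>
    hnot ((isShortest_of_isPath hT hR).mem_interval ht)
  -- shortest paths from the neighbours of `t` avoid `t`
  have avoid : ∀ s, s ≠ t → ∃ P : T.Walk (toward T t s) s, P.IsPath ∧ t ∉ P.support := by
    intro s hs
    obtain ⟨P, hP, hl⟩ := hT.1.exists_path_of_dist (toward T t s) s
    refine ⟨P, hP, fun ht => ?_⟩
    have h₁ : T.dist (toward T t s) t + T.dist t s = T.dist (toward T t s) s :=
      (isShortest_of_isPath hT hP).mem_interval ht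
    have h₂ := dist_toward hT hs
    omega
  obtain ⟨P, hP, htP⟩ := avoid s hs
  obtain ⟨Q, hQ, htQ⟩ := avoid s' hs'
  have hPR : t ∉ (P.append R).bypass.support := fun ht => by
    have := (P.append R).support_bypass_subset_support ht
    rw [SimpleGraph.Walk.mem_support_append_iff] at this
    exact this.elim htP htR
  have h₁ : (SimpleGraph.Walk.cons (toward_spec hT hs).1 (P.append R).bypass).IsPath :=
    (SimpleGraph.Walk.cons_isPath_iff _ _).2 ⟨(P.append R).bypass_isPath, hPR⟩
  have h₂ : (SimpleGraph.Walk.cons (toward_spec hT hs').1 Q).IsPath :=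
    (SimpleGraph.Walk.cons_isPath_iff _ _).2 ⟨hQ, htQ⟩
  have h₃ := (hT.existsUnique_path t s').unique h₁ h₂
  have h₄ := congrArg (fun P => P.getVert 1) h₃
  simp only [SimpleGraph.Walk.getVert_cons_succ, SimpleGraph.Walk.getVert_zero] at h₄
  exact h h₄

/-- Betweenness in the tree becomes a comparison of directions at `t`. The implication form covers
the case `s = s' = t`, where the directions agree although `t` lies between. -/
theorem mem_interval_iff_toward (hT : T.IsTree) {t s s' : W} :
    t ∈ interval T s s' ↔ (toward T t s = toward T t s' → s = t) := by
  constructor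
  · intro ht heq
    by_contra hs
    have hs' : s' ≠ t := fun h =>
      hs ((toward_eq_self_iff hT).1 (heq.trans ((toward_eq_self_iff hT).2 h)))
    have h₁ := dist_toward hT hs
    have h₂ := dist_toward hT hs'
    have h₃ : T.dist s t + T.dist t s' = T.dist s s' := ht
    have h₄ := hT.1.dist_triangle (u := s) (v := toward T t s) (w := s')
    rw [T.dist_comm (u := s) (v := toward T t s), heq] at h₄
    rw [T.dist_comm (u := s) (v := t)] at h₃
    rw [heq] at h₁
    omega
  · intro h
    by_cases heq : toward T t s = toward T t s'
    · rw [h heq]; exact left_mem_interval _ _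
    · exact mem_interval_of_toward_ne hT heq

theorem toward_eq_of_adj_of_mem (hT : T.IsTree) {t n s : W} (hadj : T.Adj t n)
    (h : n ∈ interval T t s) : toward T t s = n := by
  have hn : toward T t n = n := by
    have h₁ := dist_toward hT hadj.ne'
    rw [SimpleGraph.dist_eq_one_iff_adj.2 hadj] at h₁
    exact hT.1.dist_eq_zero_iff.1 (by omega)
  by_contra hne
  have h₁ : T.dist n t + T.dist t s = T.dist n s :=
    mem_interval_of_toward_ne hT (fun h => hne (h.symm.trans hn))
  have h₂ : T.dist t n + T.dist n s = T.dist t s := h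
  rw [T.dist_comm, SimpleGraph.dist_eq_one_iff_adj.2 hadj] at h₁
  omega

theorem toward_of_adj (hT : T.IsTree) {t n : W} (hadj : T.Adj t n) : toward T t n = n :=
  toward_eq_of_adj_of_mem hT hadj (right_mem_interval _ _)

theorem toward_eq_toward_of_adj (hT : T.IsTree) {t u v : W} (hadj : T.Adj u v) (hu : u ≠ t)
    (hv : v ≠ t) : toward T t u = toward T t v := by
  by_contra hne
  have h₁ : T.dist u t + T.dist t v = T.dist u v := mem_interval_of_toward_ne hT hne
  rw [SimpleGraph.dist_eq_one_iff_adj.2 hadj] at h₁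
  have h₂ := hT.1.pos_dist_of_ne hu
  have h₃ := hT.1.pos_dist_of_ne hv.symm
  omega

theorem eq_of_mem_interval_self {X : Type*} {Γ : SimpleGraph X} {x w : X}
    (hr : Γ.Reachable x w) (h : w ∈ interval Γ x x) : w = x := by
  have h₁ : Γ.dist x w + Γ.dist w x = Γ.dist x x := h
  rw [SimpleGraph.dist_self] at h₁
  exact (hr.dist_eq_zero_iff.1 (by omega)).symm

theorem eq_or_eq_of_mem_interval_of_adj {X : Type*} {Γ : SimpleGraph X} (hΓ : Γ.Connected)
    {x y w : X} (hadj : Γ.Adj x y) (h : w ∈ interval Γ x y) : w = x ∨ w = y := by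
  have h₁ : Γ.dist x w + Γ.dist w y = Γ.dist x y := h
  rw [SimpleGraph.dist_eq_one_iff_adj.2 hadj] at h₁
  by_cases h₀ : Γ.dist x w = 0
  · exact Or.inl (hΓ.dist_eq_zero_iff.1 h₀).symm
  · exact Or.inr (hΓ.dist_eq_zero_iff.1 (by omega))

/-- The direction from `w` to `z` cannot agree with both of the different directions to `x` and `y`.
-/
theorem thinIntervals_of_isTree (hT : T.IsTree) : ThinIntervals T 0 := by
  intro x y z w hw
  refine ⟨w, ?_, by simp⟩
  rw [mem_interval_iff_toward hT] at hw
  by_cases h : toward T w x = toward T w z ∧ x ≠ w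
  · right
    rw [mem_interval_iff_toward hT]
    exact fun h' => absurd (hw (h.1.trans h')) h.2
  · left
    rw [mem_interval_iff_toward hT]
    exact fun h' => not_not.1 fun hne => h ⟨h', hne⟩

/-- A sequence that moves along edges can change its direction as seen from `a` only by passing
through `a`. -/
theorem eventually_toward_eq (hT : T.IsTree) {t : ℕ → W}
    (ht : ∀ n, t n = t (n + 1) ∨ T.Adj (t n) (t (n + 1))) {a : W} (ha : ∀ᶠ n in atTop, t n ≠ a) :
    ∃ b, T.Adj a b ∧ ∀ᶠ n in atTop, toward T a (t n) = b := by
  obtain ⟨n₀, hn₀⟩ := ha.exists_forall_of_atTop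
  refine ⟨toward T a (t n₀), (toward_spec hT (hn₀ _ le_rfl)).1, ?_⟩
  filter_upwards [eventually_ge_atTop n₀] with n hn
  induction n, hn using Nat.le_induction with
  | base => rfl
  | succ n hn ih =>
    rw [← ih]
    rcases ht n with h | h
    · rw [h]
    · exact (toward_eq_toward_of_adj hT h (hn₀ n hn) (hn₀ (n + 1) (by omega))).symm

theorem GeodesicRay.eventually_ne {X : Type*} {Γ : SimpleGraph X} (r : GeodesicRay Γ) (a : X) :
    ∀ᶠ n in atTop, r.vertex n ≠ a := by
  filter_upwards [eventually_gt_atTop (Γ.dist (r.vertex 0) a)] with n hn h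
  rw [← h, r.dist_zero] at hn
  omega

theorem GeodesicRay.eventually_toward_eq (hT : T.IsTree) (r : GeodesicRay T) (a : W) :
    ∃ b, T.Adj a b ∧ ∀ᶠ n in atTop, toward T a (r.vertex n) = b :=
  TreeAmalgam.eventually_toward_eq hT (fun n => Or.inr (r.adj_succ n)) (r.eventually_ne a)

theorem GeodesicRay.toward_vertex (hT : T.IsTree) (r : GeodesicRay T) {m n : ℕ} (h : m < n) :
    toward T (r.vertex m) (r.vertex n) = r.vertex (m + 1) :=
  toward_eq_of_adj_of_mem hT (r.adj_succ m) (r.mem_interval (Nat.le_succ m) h)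

theorem GeodesicRay.mem_interval_of_toward_eq (hT : T.IsTree) (r : GeodesicRay T) {m : ℕ} {s : W}
    (h : toward T (r.vertex m) s = r.vertex (m + 1)) :
    r.vertex m ∈ interval T (r.vertex 0) s := by
  rw [mem_interval_iff_toward hT, h, ← toward_of_adj hT (r.adj_succ m),
    ← mem_interval_iff_toward hT]
  exact r.mem_interval (Nat.zero_le m) (Nat.le_succ m)

theorem FourPoint.of_isTree (hT : T.IsTree) : FourPoint T 1 := by
  simpa using (thinIntervals_of_isTree hT).fourPoint hT.1

/-- Inequivalent rays in a tree are separated by an edge of the first one. -/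
theorem exists_eventually_toward_ne (hT : T.IsTree) {r s : GeodesicRay T}
    (h : ¬ CoConvergent T r.vertex s.vertex) :
    ∃ m, ∀ᶠ n in atTop, toward T (r.vertex m) (s.vertex n) ≠ r.vertex (m + 1) := by
  -- Otherwise, for every `m`, infinitely many `s.vertex j` lie beyond the edge from `r.vertex m` to
  -- `r.vertex (m + 1)`, so their Gromov product with `r.vertex m` is `m`.
  by_contra! hcon
  refine h ((r.isGromovSequence hT.1).coConvergent hT.1 (.of_isTree hT) zero_le_one
    (s.isGromovSequence hT.1) (r.vertex 0) fun M n => ?_)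
  have hf := hcon (max ⌈M⌉₊ n)
  obtain ⟨j, hj, hnj⟩ := (Filter.Frequently.and_eventually
    (by simpa [Filter.Frequently] using hf) (eventually_ge_atTop n)).exists
  refine ⟨max ⌈M⌉₊ n, le_max_right _ _, j, hnj, ?_⟩
  rw [gromovProduct_eq_dist_of_mem (r.mem_interval_of_toward_eq hT hj), r.dist_zero]
  exact (Nat.le_ceil M).trans (by exact_mod_cast le_max_left _ _)

end Tree

/-! ### Trees of graphs -/

section TreeOfGraphs

variable {X W : Type*} {Γ : SimpleGraph X} {T : SimpleGraph W} {τ : X → W} {N δ : ℕ}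

/-- The edges of `Γ` inside the fibres of `τ`. -/
def fibreGraph (Γ : SimpleGraph X) (τ : X → W) : SimpleGraph X where
  Adj x y := Γ.Adj x y ∧ τ x = τ y
  symm := ⟨fun _ _ h => ⟨h.1.symm, h.2.symm⟩⟩
  loopless := ⟨fun _ h => Γ.irrefl h.1⟩

/-- The graph `Γ` is arranged along the tree `T` by `τ`: its fibres are uniformly hyperbolic and
locally finite, and the sets in which neighbouring fibres meet have bounded diameter. -/
structure TreeOfGraphs (Γ : SimpleGraph X) (T : SimpleGraph W) (τ : X → W) (N δ : ℕ) : Prop where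
  isTree : T.IsTree
  surjective : Function.Surjective τ
  adj : ∀ {x y}, Γ.Adj x y → τ x = τ y ∨ T.Adj (τ x) (τ y)
  reachable : ∀ {x y}, τ x = τ y → (fibreGraph Γ τ).Reachable x y
  exists_adj : ∀ {a b}, T.Adj a b → ∃ x y, τ x = a ∧ τ y = b ∧ Γ.Adj x y
  adhesion : ∀ {x y x' y'}, Γ.Adj x y → Γ.Adj x' y' → τ x = τ x' → τ y = τ y' → τ x ≠ τ y →
    (fibreGraph Γ τ).dist x x' ≤ N
  thin : ∀ {x y z w}, τ y = τ x → τ z = τ x → τ w = τ x → w ∈ interval (fibreGraph Γ τ) x y →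
    ∃ w', τ w' = τ x ∧ (w' ∈ interval (fibreGraph Γ τ) x z ∨ w' ∈ interval (fibreGraph Γ τ) z y) ∧
      (fibreGraph Γ τ).dist w w' ≤ δ
  -- `Γ` may have vertices of infinite degree, so compactness arguments have to take place in balls
  -- of fibres.
  finite : ∀ x n, {y | τ y = τ x ∧ (fibreGraph Γ τ).dist x y ≤ n}.Finite

/-- Vertices `gate a b` of the fibre over `a`, one for every edge `ab` of the tree, such that
`gate a b` and `gate b a` are adjacent. -/
def IsGate (Γ : SimpleGraph X) (T : SimpleGraph W) (τ : X → W) (gate : W → W → X) : Prop :=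
  ∀ a b, T.Adj a b → τ (gate a b) = a ∧ Γ.Adj (gate a b) (gate b a)

theorem fibreGraph_le : fibreGraph Γ τ ≤ Γ := fun _ _ h => h.1

theorem tau_eq_of_fibre_reachable {x y : X} (h : (fibreGraph Γ τ).Reachable x y) : τ x = τ y := by
  obtain ⟨P⟩ := h
  induction P with
  | nil => rfl
  | cons h _ ih => exact h.2.trans ih

/-- A pseudometric that is bounded on edges is bounded by a multiple of the graph distance. -/
theorem le_mul_dist_of_adj (hΓ : Γ.Connected) {d : X → X → ℕ} {C : ℕ} (h₀ : ∀ x, d x x = 0)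
    (htri : ∀ x y z, d x z ≤ d x y + d y z) (hadj : ∀ x y, Γ.Adj x y → d x y ≤ C) (x y : X) :
    d x y ≤ C * Γ.dist x y := by
  obtain ⟨P, hP⟩ := hΓ.exists_walk_length_eq_dist x y
  rw [← hP]
  clear hP
  induction P with
  | nil => simp [h₀]
  | @cons u v w h P ih =>
    have h₁ := htri u v w
    have h₂ := hadj u v h
    rw [SimpleGraph.Walk.length_cons, mul_add, mul_one]
    omega

namespace TreeOfGraphs

theorem exists_isGate (M : TreeOfGraphs Γ T τ N δ) : ∃ gate, IsGate Γ T τ gate := by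
  classical
  have : ∀ a b, ∃ p : X × X, T.Adj a b → τ p.1 = a ∧ τ p.2 = b ∧ Γ.Adj p.1 p.2 := by
    intro a b
    by_cases h : T.Adj a b
    · obtain ⟨x, y, hx, hy, hxy⟩ := M.exists_adj h
      exact ⟨(x, y), fun _ => ⟨hx, hy, hxy⟩⟩
    · obtain ⟨x, -⟩ := M.surjective a
      exact ⟨(x, x), fun h' => absurd h' h⟩
  choose p hp using this
  let r : W → W → Prop := WellOrderingRel
  -- Both gates of a tree edge must be ends of the same edge of `Γ`; a well-order selects one
  -- orientation of every tree edge.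
  refine ⟨fun a b => if r a b then (p a b).1 else (p b a).2, fun a b hab => ?_⟩
  rcases trichotomous_of r a b with h | h | h
  · have h' : ¬ r b a := asymm_of r h
    simp only [h, h', if_true, if_false]
    exact ⟨(hp a b hab).1, (hp a b hab).2.2⟩
  · exact absurd h hab.ne
  · have h' : ¬ r a b := asymm_of r h
    simp only [h, h', if_true, if_false]
    exact ⟨(hp b a hab.symm).2.1, (hp b a hab.symm).2.2.symm⟩

theorem connected (M : TreeOfGraphs Γ T τ N δ) : Γ.Connected := by
  have hreach : ∀ a b (_ : T.Walk a b) x y, τ x = a → τ y = b → Γ.Reachable x y := by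
    intro a b P
    induction P with
    | nil =>
      intro x y hx hy
      exact (M.reachable (hx.trans hy.symm)).mono fibreGraph_le
    | cons h P ih =>
      intro x y hx hy
      obtain ⟨x', y', hx', hy', hadj⟩ := M.exists_adj h
      exact (((M.reachable (hx.trans hx'.symm)).mono fibreGraph_le).trans hadj.reachable).trans
        (ih y' y hy' hy)
  have : Nonempty X := by
    obtain ⟨a⟩ := M.isTree.1.nonempty
    exact ⟨(M.surjective a).choose⟩
  refine ⟨fun x y => ?_⟩
  obtain ⟨P⟩ := M.isTree.1.preconnected (τ x) (τ y)
  exact hreach _ _ P x y rfl rfl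

theorem fibre_dist_triangle (M : TreeOfGraphs Γ T τ N δ) {x y z : X} (h : τ x = τ y) :
    (fibreGraph Γ τ).dist x z ≤ (fibreGraph Γ τ).dist x y + (fibreGraph Γ τ).dist y z :=
  (M.reachable h).dist_triangle_left z

theorem dist_le_fibre_dist (M : TreeOfGraphs Γ T τ N δ) {x y : X} (h : τ x = τ y) :
    Γ.dist x y ≤ (fibreGraph Γ τ).dist x y :=
  (M.reachable h).dist_anti fibreGraph_le

theorem tree_dist_le (M : TreeOfGraphs Γ T τ N δ) (x y : X) : T.dist (τ x) (τ y) ≤ Γ.dist x y := by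
  have := le_mul_dist_of_adj M.connected (d := fun x y => T.dist (τ x) (τ y)) (C := 1)
    (by simp) (fun _ _ _ => M.isTree.1.dist_triangle) (fun x y h => ?_) x y
  · simpa using this
  · rcases M.adj h with h | h
    · simp [h]
    · exact (SimpleGraph.dist_eq_one_iff_adj.2 h).le

/-- A shortest path between two sides of an edge of the tree uses an edge over it. -/
theorem exists_crossing (M : TreeOfGraphs Γ T τ N δ) {a b : W} {x y : X} (hx : toward T a (τ x) ≠ b)
    (hy : toward T a (τ y) = b) (hab : T.Adj a b) :
    ∃ p q, Γ.Adj p q ∧ τ p = a ∧ τ q = b ∧ p ∈ interval Γ x y ∧ q ∈ interval Γ x y := by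
  obtain ⟨p, q, hpq, hp, hq, hpI, hqI⟩ := exists_boundary_mem_interval M.connected
    (S := {x | toward T a (τ x) ≠ b}) hx (by simpa using hy)
  simp only [Set.mem_ofPred_eq, not_not] at hp hq
  have hne : τ p ≠ τ q := fun h => hp (by rw [h]; exact hq)
  have hadj := (M.adj hpq).resolve_left hne
  have hqa : τ q ≠ a := fun h => hab.ne (by rw [← hq, h, toward_self])
  have hpa : τ p = a := by
    by_contra hpa
    exact hp ((toward_eq_toward_of_adj M.isTree hadj hpa hqa).trans hq)
  refine ⟨p, q, hpq, hpa, ?_, hpI, hqI⟩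
  rw [hpa] at hadj
  rw [← toward_of_adj M.isTree hadj, hq]

/-- Gromov products across an edge of the tree are bounded. -/
theorem exists_gromovProduct_le (M : TreeOfGraphs Γ T τ N δ) {a b : W} (hab : T.Adj a b) (o : X) :
    ∃ C : ℝ, ∀ x y, toward T a (τ x) ≠ b → toward T a (τ y) = b →
      gromovProduct Γ o x y ≤ C := by
  obtain ⟨x₀, y₀, hx₀, hy₀, h₀⟩ := M.exists_adj hab
  refine ⟨Γ.dist o x₀ + N, fun x y hx hy => ?_⟩
  obtain ⟨p, q, hpq, hp, hq, hpI, -⟩ := M.exists_crossing hx hy hab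
  refine (gromovProduct_le_dist_of_mem M.connected hpI).trans ?_
  have h₁ := M.adhesion h₀ hpq (hx₀.trans hp.symm) (hy₀.trans hq.symm)
    (by rw [hx₀, hy₀]; exact hab.ne)
  have h₂ := M.dist_le_fibre_dist (hx₀.trans hp.symm)
  have h₃ := M.connected.dist_triangle (u := o) (v := x₀) (w := p)
  exact_mod_cast (by omega : Γ.dist o p ≤ Γ.dist o x₀ + N)

end TreeOfGraphs

/-! ### Gates, projections to fibres and gate paths -/

open Classical in
/-- The vertex of the fibre over `t` through which `x` is reached from that fibre. -/
noncomputable def gateProj (T : SimpleGraph W) (τ : X → W) (gate : W → W → X) (t : W) (x : X) : X :=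
  if τ x = t then x else gate t (toward T t (τ x))

/-- The union of the shortest paths inside the fibres between the gates on the way from `x`
to `y`. -/
def gatePath (Γ : SimpleGraph X) (T : SimpleGraph W) (τ : X → W) (gate : W → W → X) (x y : X) :
    Set X :=
  {w | τ w ∈ interval T (τ x) (τ y) ∧
    w ∈ interval (fibreGraph Γ τ) (gateProj T τ gate (τ w) x) (gateProj T τ gate (τ w) y)}

variable {gate : W → W → X}

theorem gateProj_of_eq {t : W} {x : X} (h : τ x = t) : gateProj T τ gate t x = x := by
  simp [gateProj, h]

theorem gateProj_of_ne {t : W} {x : X} (h : τ x ≠ t) :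
    gateProj T τ gate t x = gate t (toward T t (τ x)) := by
  simp [gateProj, h]

theorem gateProj_congr (hT : T.IsTree) {t : W} {x y : X} (hx : τ x ≠ t)
    (h : toward T t (τ x) = toward T t (τ y)) :
    gateProj T τ gate t x = gateProj T τ gate t y := by
  have hy : τ y ≠ t := fun hy =>
    hx ((toward_eq_self_iff hT).1 (h.trans ((toward_eq_self_iff hT).2 hy)))
  rw [gateProj_of_ne hx, gateProj_of_ne hy, h]

theorem IsGate.tau_gateProj (hT : T.IsTree) (hg : IsGate Γ T τ gate) (t : W) (x : X) :
    τ (gateProj T τ gate t x) = t := by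
  by_cases h : τ x = t
  · rw [gateProj_of_eq h, h]
  · rw [gateProj_of_ne h]
    exact (hg _ _ (toward_spec hT h).1).1

namespace TreeOfGraphs

theorem fibre_dist_gate_le (M : TreeOfGraphs Γ T τ N δ)
    (hg : IsGate Γ T τ gate) {x y : X} (hxy : Γ.Adj x y)
    (hne : τ x ≠ τ y) : (fibreGraph Γ τ).dist x (gate (τ x) (τ y)) ≤ N := by
  have hadj := (M.adj hxy).resolve_left hne
  exact M.adhesion hxy (hg _ _ hadj).2 (hg _ _ hadj).1.symm (hg _ _ hadj.symm).1.symm hne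

/-- An edge inside the fibre moves the projection by one, an edge leaving it by at most `N` through
bounded adhesion. Any other edge has both ends in the same direction, hence projects to a single
gate. -/
theorem fibre_dist_gateProj_le_of_adj (M : TreeOfGraphs Γ T τ N δ)
    (hg : IsGate Γ T τ gate) (t : W) {x y : X}
    (hxy : Γ.Adj x y) :
    (fibreGraph Γ τ).dist (gateProj T τ gate t x) (gateProj T τ gate t y) ≤ N + 1 := by
  by_cases hx : τ x = t <;> by_cases hy : τ y = t
  · rw [gateProj_of_eq hx, gateProj_of_eq hy]
    have : (fibreGraph Γ τ).Adj x y := ⟨hxy, hx.trans hy.symm⟩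
    rw [SimpleGraph.dist_eq_one_iff_adj.2 this]
    omega
  · have hne : τ x ≠ τ y := fun h => hy (h ▸ hx)
    have hadj := (M.adj hxy).resolve_left hne
    rw [gateProj_of_eq hx, gateProj_of_ne hy, ← hx, toward_of_adj M.isTree hadj]
    exact (M.fibre_dist_gate_le hg hxy hne).trans (Nat.le_succ N)
  · have hne : τ y ≠ τ x := fun h => hx (h ▸ hy)
    have hadj := (M.adj hxy.symm).resolve_left hne
    rw [gateProj_of_eq hy, gateProj_of_ne hx, ← hy, toward_of_adj M.isTree hadj,
      SimpleGraph.dist_comm]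
    exact (M.fibre_dist_gate_le hg hxy.symm hne).trans (Nat.le_succ N)
  · have : toward T t (τ x) = toward T t (τ y) := by
      rcases M.adj hxy with h | h
      · rw [h]
      · exact toward_eq_toward_of_adj M.isTree h hx hy
    rw [gateProj_congr M.isTree hx this]
    simp

theorem fibre_dist_gateProj_le (M : TreeOfGraphs Γ T τ N δ)
    (hg : IsGate Γ T τ gate) (t : W) (x y : X) :
    (fibreGraph Γ τ).dist (gateProj T τ gate t x) (gateProj T τ gate t y) ≤
      (N + 1) * Γ.dist x y := by
  refine le_mul_dist_of_adj M.connected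
    (d := fun x y => (fibreGraph Γ τ).dist (gateProj T τ gate t x) (gateProj T τ gate t y))
    (by simp) (fun x y z => M.fibre_dist_triangle ?_)
    (fun x y h => M.fibre_dist_gateProj_le_of_adj hg t h) x y
  rw [hg.tau_gateProj M.isTree, hg.tau_gateProj M.isTree]

/-- Fibres are undistorted. -/
theorem fibre_dist_le (M : TreeOfGraphs Γ T τ N δ) {x y : X} (h : τ x = τ y) :
    (fibreGraph Γ τ).dist x y ≤ (N + 1) * Γ.dist x y := by
  obtain ⟨gate, hg⟩ := M.exists_isGate
  have := M.fibre_dist_gateProj_le hg (τ x) x y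
  rwa [gateProj_of_eq rfl, gateProj_of_eq h.symm] at this

theorem exists_walk_mem_interval (M : TreeOfGraphs Γ T τ N δ) {x y : X} (h : τ x = τ y) :
    ∃ P : Γ.Walk x y, ∀ a ∈ P.support, τ a = τ x ∧ a ∈ interval (fibreGraph Γ τ) x y := by
  classical
  obtain ⟨P, hP⟩ := (M.reachable h).exists_walk_length_eq_dist
  refine ⟨P.mapLe fibreGraph_le, fun a ha => ?_⟩
  have ha : a ∈ P.support := by simpa using ha
  exact ⟨(tau_eq_of_fibre_reachable (P.takeUntil a ha).reachable).symm,
    IsShortest.mem_interval (P := P) hP ha⟩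

theorem exists_walk_gatePath (M : TreeOfGraphs Γ T τ N δ) (hg : IsGate Γ T τ gate) (x y : X) :
    ∃ P : Γ.Walk x y, ∀ a ∈ P.support, a ∈ gatePath Γ T τ gate x y := by
  induction hn : T.dist (τ x) (τ y) generalizing x with
  | zero =>
    have h : τ x = τ y := M.isTree.1.dist_eq_zero_iff.1 hn
    obtain ⟨P, hP⟩ := M.exists_walk_mem_interval h
    refine ⟨P, fun a ha => ?_⟩
    obtain ⟨h₁, h₂⟩ := hP a ha
    refine ⟨by rw [h₁]; exact left_mem_interval _ _, ?_⟩
    rwa [gateProj_of_eq h₁.symm, gateProj_of_eq (h.symm.trans h₁.symm)]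
  | succ n ih =>
    have hne : τ y ≠ τ x := fun h => by simp [h] at hn
    obtain ⟨hadj, hmem⟩ := toward_spec M.isTree hne
    have hd := dist_toward M.isTree hne
    set b := toward T (τ x) (τ y) with hb
    obtain ⟨h₁, h₂⟩ := hg _ _ hadj
    obtain ⟨h₃, -⟩ := hg _ _ hadj.symm
    obtain ⟨P, hP⟩ := M.exists_walk_mem_interval h₁.symm
    obtain ⟨Q, hQ⟩ := ih (gate b (τ x)) (by rw [h₃]; omega)
    refine ⟨P.append (Q.cons h₂), fun w hw => ?_⟩
    rw [SimpleGraph.Walk.mem_support_append_iff, SimpleGraph.Walk.support_cons,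
      List.mem_cons] at hw
    have left : w ∈ P.support → w ∈ gatePath Γ T τ gate x y := by
      intro hw
      obtain ⟨h₄, h₅⟩ := hP w hw
      refine ⟨by rw [h₄]; exact left_mem_interval _ _, ?_⟩
      rwa [gateProj_of_eq h₄.symm, h₄, gateProj_of_ne hne]
    rcases hw with hw | rfl | hw
    · exact left hw
    · exact left P.end_mem_support
    · obtain ⟨h₄, h₅⟩ := hQ w hw
      rw [h₃] at h₄
      refine ⟨(mem_interval_trans M.isTree.1 hmem h₄).1, ?_⟩
      have hwx : τ x ≠ τ w := by
        intro h
        have h₆ : T.dist b (τ w) + T.dist (τ w) (τ y) = T.dist b (τ y) := h₄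
        rw [← h] at h₆
        omega
      -- Seen from any later fibre, `x` and the vertex where the walk enters the fibre over `b`
      -- project alike, so the walk supplied by induction is also part of the gate path from `x`.
      have key : gateProj T τ gate (τ w) x = gateProj T τ gate (τ w) (gate b (τ x)) := by
        by_cases hwb : τ w = b
        · rw [gateProj_of_ne hwx, gateProj_of_eq (h₃.trans hwb.symm), hwb,
            toward_of_adj M.isTree hadj.symm]
        · refine gateProj_congr M.isTree hwx ?_
          rw [h₃]
          exact toward_eq_toward_of_adj M.isTree hadj hwx (Ne.symm hwb)
      rwa [key]

theorem guessedGeodesics (M : TreeOfGraphs Γ T τ N δ) (hg : IsGate Γ T τ gate) :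
    GuessedGeodesics Γ (gatePath Γ T τ gate) (δ + N + 2) where
  exists_walk := M.exists_walk_gatePath hg
  thin := by
    intro x y z w hw
    obtain ⟨h₁, h₂⟩ := hw
    -- If `z` lies in the same direction as `x` or as `y`, outside the fibre of `w`, the projections
    -- coincide and `w` itself lies on another side. Otherwise the fibre lies on all three tree
    -- paths, and the projections span a thin triangle inside it.
    by_cases hA : toward T (τ w) (τ x) = toward T (τ w) (τ z) ∧ τ x ≠ τ w
    · refine ⟨w, Or.inr ⟨?_, ?_⟩, by simp⟩
      · rw [mem_interval_iff_toward M.isTree] at h₁ ⊢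
        exact fun h => absurd (h₁ (hA.1.trans h)) hA.2
      · rwa [← gateProj_congr M.isTree hA.2 hA.1]
    by_cases hB : toward T (τ w) (τ y) = toward T (τ w) (τ z) ∧ τ y ≠ τ w
    · refine ⟨w, Or.inl ⟨?_, ?_⟩, by simp⟩
      · rw [mem_interval_comm, mem_interval_iff_toward M.isTree] at h₁ ⊢
        exact fun h => not_not.1 fun _ => hB.2 (h₁ (hB.1.trans h))
      · rwa [← gateProj_congr M.isTree hB.2 hB.1]
    have hx := hg.tau_gateProj M.isTree (τ w) x
    have hy := hg.tau_gateProj M.isTree (τ w) y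
    have hz := hg.tau_gateProj M.isTree (τ w) z
    obtain ⟨w', hτ, hw', hd⟩ := M.thin (hy.trans hx.symm) (hz.trans hx.symm) hx.symm h₂
    rw [hx] at hτ
    refine ⟨w', ?_, (M.dist_le_fibre_dist hτ.symm).trans (by omega)⟩
    rw [← hτ] at hA hB hw'
    refine hw'.imp (fun hw' => ⟨?_, hw'⟩) (fun hw' => ⟨?_, hw'⟩)
    · rw [mem_interval_iff_toward M.isTree]
      exact fun h => not_not.1 fun hne => hA ⟨h, hne⟩
    · rw [mem_interval_comm, mem_interval_iff_toward M.isTree]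
      exact fun h => not_not.1 fun hne => hB ⟨h, hne⟩
  small := by
    intro x y w hd hw
    obtain ⟨h₁, h₂⟩ := hw
    have hbound : ∀ {p q : X}, τ p = τ w → w ∈ interval (fibreGraph Γ τ) p q →
        Γ.dist p w ≤ (fibreGraph Γ τ).dist p q := by
      intro p q hp hw
      have h₃ := M.dist_le_fibre_dist hp
      have h₄ : (fibreGraph Γ τ).dist p w + (fibreGraph Γ τ).dist w q =
        (fibreGraph Γ τ).dist p q := hw
      omega
    have hpx := hbound (hg.tau_gateProj M.isTree _ _) h₂
    have hpy := hbound (hg.tau_gateProj M.isTree _ _) (mem_interval_comm.1 h₂)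
    have hle := (M.fibre_dist_gateProj_le hg (τ w) x y).trans (Nat.mul_le_mul_left (N + 1) hd)
    rw [SimpleGraph.dist_comm] at hpy
    -- The projections of `x` and `y` have fibre distance at most `N + 1`. If `w` lies over `τ y`,
    -- going on from `y` to `x` costs one more, whence `N + 2`.
    have hτ : τ w = τ x ∨ τ w = τ y := by
      have h₃ := M.tree_dist_le x y
      by_cases h₄ : T.dist (τ x) (τ y) = 0
      · rw [← M.isTree.1.dist_eq_zero_iff.1 h₄] at h₁
        exact Or.inl (eq_of_mem_interval_self (M.isTree.1.preconnected _ _) h₁)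
      · exact eq_or_eq_of_mem_interval_of_adj M.isTree.1
          (SimpleGraph.dist_eq_one_iff_adj.1 (by omega)) h₁
    rcases hτ with hτ | hτ
    · rw [gateProj_of_eq hτ.symm] at hpx hle
      rw [SimpleGraph.dist_comm]
      omega
    · rw [gateProj_of_eq hτ.symm] at hpy
      rw [gateProj_of_eq hτ.symm] at hle
      have h₃ := M.connected.dist_triangle (u := w) (v := y) (w := x)
      rw [Γ.dist_comm (u := y) (v := x)] at h₃
      rw [SimpleGraph.dist_comm (u := y)] at hpy
      omega

end TreeOfGraphs

end TreeOfGraphs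

/-! ### Pieces of a tree of graphs -/

section Pieces

variable {X Y W : Type*} {Γ : SimpleGraph X} {Δ : SimpleGraph Y} {T : SimpleGraph W} {τ : X → W}
  {N δ : ℕ} {t : W} {ι : Y → X} {gate : W → W → X}

/-- `ι` identifies the graph `Δ` with the subgraph of `Γ` induced by the fibre of `τ` over `t`. -/
structure IsPiece (Δ : SimpleGraph Y) (Γ : SimpleGraph X) (τ : X → W) (t : W) (ι : Y → X) :
    Prop where
  injective : Function.Injective ι
  tau : ∀ a, τ (ι a) = t
  exists_eq : ∀ x, τ x = t → ∃ a, ι a = x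
  adj_iff : ∀ {a b}, Γ.Adj (ι a) (ι b) ↔ Δ.Adj a b

namespace IsPiece

theorem exists_walk (hι : IsPiece Δ Γ τ t ι) {a b : Y} (P : Δ.Walk a b) :
    ∃ Q : (fibreGraph Γ τ).Walk (ι a) (ι b), Q.length = P.length := by
  induction P with
  | nil => exact ⟨.nil, rfl⟩
  | @cons u v w h P ih =>
    obtain ⟨Q, hQ⟩ := ih
    have h' : (fibreGraph Γ τ).Adj (ι u) (ι v) :=
      ⟨hι.adj_iff.2 h, by rw [hι.tau, hι.tau]⟩
    exact ⟨Q.cons h', by simp [hQ]⟩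

theorem exists_walk_lift (hι : IsPiece Δ Γ τ t ι) {x y : X} (P : (fibreGraph Γ τ).Walk x y) :
    ∀ a b, ι a = x → ι b = y → ∃ Q : Δ.Walk a b, Q.length = P.length := by
  induction P with
  | nil =>
    intro a b ha hb
    obtain rfl := hι.injective (ha.trans hb.symm)
    exact ⟨.nil, rfl⟩
  | @cons u v w h P ih =>
    intro a b ha hb
    obtain ⟨a', ha'⟩ := hι.exists_eq v (by rw [← h.2, ← ha, hι.tau])
    obtain ⟨Q, hQ⟩ := ih a' b ha' hb
    have h' : Δ.Adj a a' := hι.adj_iff.1 (by rw [ha, ha']; exact h.1)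
    exact ⟨Q.cons h', by simp [hQ]⟩

theorem dist_eq (hι : IsPiece Δ Γ τ t ι) (hΔ : Δ.Connected) (a b : Y) :
    (fibreGraph Γ τ).dist (ι a) (ι b) = Δ.dist a b := by
  obtain ⟨P, hP⟩ := hΔ.exists_walk_length_eq_dist a b
  obtain ⟨P', hP'⟩ := hι.exists_walk P
  obtain ⟨Q, hQ⟩ := P'.reachable.exists_walk_length_eq_dist
  obtain ⟨Q', hQ'⟩ := hι.exists_walk_lift Q a b rfl rfl
  have h₁ := SimpleGraph.dist_le P'
  have h₂ := SimpleGraph.dist_le Q'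
  omega

theorem mem_interval_iff (hι : IsPiece Δ Γ τ t ι) (hΔ : Δ.Connected) {a b w : Y} :
    ι w ∈ interval (fibreGraph Γ τ) (ι a) (ι b) ↔ w ∈ interval Δ a b := by
  simp only [interval, Set.mem_ofPred_eq, hι.dist_eq hΔ]

theorem reachable (hι : IsPiece Δ Γ τ t ι) (hΔ : Δ.Connected) {x y : X} (hx : τ x = t)
    (hy : τ y = t) : (fibreGraph Γ τ).Reachable x y := by
  obtain ⟨a, rfl⟩ := hι.exists_eq x hx
  obtain ⟨b, rfl⟩ := hι.exists_eq y hy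
  obtain ⟨P⟩ := hΔ.preconnected a b
  obtain ⟨Q, -⟩ := hι.exists_walk P
  exact Q.reachable

theorem thin (hι : IsPiece Δ Γ τ t ι) (hΔ : Δ.Connected) (hδ : ThinIntervals Δ δ) {x y z w : X}
    (hx : τ x = t) (hy : τ y = t) (hz : τ z = t) (hw : τ w = t)
    (h : w ∈ interval (fibreGraph Γ τ) x y) :
    ∃ w', τ w' = t ∧ (w' ∈ interval (fibreGraph Γ τ) x z ∨ w' ∈ interval (fibreGraph Γ τ) z y) ∧
      (fibreGraph Γ τ).dist w w' ≤ δ := by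
  obtain ⟨a, rfl⟩ := hι.exists_eq x hx
  obtain ⟨b, rfl⟩ := hι.exists_eq y hy
  obtain ⟨c, rfl⟩ := hι.exists_eq z hz
  obtain ⟨d, rfl⟩ := hι.exists_eq w hw
  obtain ⟨d', h₁, h₂⟩ := hδ a b c d ((hι.mem_interval_iff hΔ).1 h)
  refine ⟨ι d', hι.tau _, ?_, by rwa [hι.dist_eq hΔ]⟩
  rwa [hι.mem_interval_iff hΔ, hι.mem_interval_iff hΔ]

theorem finite (hι : IsPiece Δ Γ τ t ι) (hΔ : Δ.Connected) (hfin : IsLocallyFinite Δ) {x : X}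
    (hx : τ x = t) (n : ℕ) : {y | τ y = t ∧ (fibreGraph Γ τ).dist x y ≤ n}.Finite := by
  obtain ⟨a, rfl⟩ := hι.exists_eq x hx
  refine ((finite_setOf_dist_le hΔ hfin a n).image ι).subset ?_
  rintro y ⟨hy, hd⟩
  obtain ⟨b, rfl⟩ := hι.exists_eq y hy
  rw [hι.dist_eq hΔ] at hd
  exact ⟨b, hd, rfl⟩

end IsPiece

theorem IsGromovSequence.eventually_ne {y : ℕ → X} (hy : IsGromovSequence Γ y) (v : X) :
    ∀ᶠ n in atTop, v ≠ y n := by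
  filter_upwards [(hy.coConvergent_self v).eventually_gt_atTop 0] with n hn h
  rw [← h] at hn
  simp [gromovProduct] at hn

/-- Gromov products in `Δ` can be large only if those of the images in `Γ` are. -/
def IsGromovProper (Δ : SimpleGraph Y) (Γ : SimpleGraph X) (ι : Y → X) : Prop :=
  ∃ C : ℝ, 0 < C ∧ ∀ o a b,
    gromovProduct Δ o a b ≤ C * gromovProduct Γ (ι o) (ι a) (ι b) + C

namespace TreeOfGraphs

/-! ### Comparison of Gromov products in `Γ`, in the tree and in a piece -/

theorem thinIntervals (M : TreeOfGraphs Γ T τ N δ) : ∃ δ', ThinIntervals Γ δ' := by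
  obtain ⟨gate, hg⟩ := M.exists_isGate
  exact (M.guessedGeodesics hg).thinIntervals M.connected

/-- A vertex of a geodesic nearly closest to `o` is close to the gate path, which lies over the tree
path from `τ x` to `τ y`; and `τ` does not increase distances. -/
theorem tree_gromovProduct_le (M : TreeOfGraphs Γ T τ N δ) : ∃ C : ℝ, 0 ≤ C ∧ ∀ o x y,
    gromovProduct T (τ o) (τ x) (τ y) ≤ gromovProduct Γ o x y + C := by
  obtain ⟨gate, hg⟩ := M.exists_isGate
  obtain ⟨K, -, hK⟩ := (M.guessedGeodesics hg).exists_close M.connected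
  obtain ⟨δ', hδ'⟩ := M.thinIntervals
  refine ⟨2 * δ' + 1 + K, by positivity, fun o x y => ?_⟩
  obtain ⟨v, hv, hvd⟩ := hδ'.exists_dist_le M.connected o x y
  obtain ⟨w, hw, hwd⟩ := hK x y v hv
  have h₁ := gromovProduct_le_dist_of_mem M.isTree.1 (o := τ o) hw.1
  have h₂ : (T.dist (τ o) (τ w) : ℝ) ≤ Γ.dist o w := by exact_mod_cast M.tree_dist_le o w
  have h₃ := dist_triangle_cast M.connected o v w
  have h₄ : (Γ.dist v w : ℝ) ≤ K := by exact_mod_cast hwd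
  linarith

theorem isGromovProper_section (M : TreeOfGraphs Γ T τ N δ)
    {σ : W → X} (hσ : ∀ a, τ (σ a) = a) : IsGromovProper T Γ σ := by
  obtain ⟨C, hC, h⟩ := M.tree_gromovProduct_le
  refine ⟨C + 1, by linarith, fun o a b => ?_⟩
  have h₁ := h (σ o) (σ a) (σ b)
  rw [hσ, hσ, hσ] at h₁
  have h₂ := mul_nonneg hC (gromovProduct_nonneg M.connected (σ o) (σ a) (σ b))
  linarith

/-- Between vertices of one fibre the gate path is the interval of the fibre, so a vertex of it
nearly closest to `o` is close to a geodesic of `Γ`. The error is purely additive, since distances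
in `Γ` are at most those in the fibre. -/
theorem gromovProduct_piece_le (M : TreeOfGraphs Γ T τ N δ)
    (hι : IsPiece Δ Γ τ t ι) (hΔ : Δ.Connected)
    (hδ : ThinIntervals Δ δ) : ∃ C : ℝ, 0 ≤ C ∧ ∀ o a b,
      gromovProduct Γ (ι o) (ι a) (ι b) ≤ gromovProduct Δ o a b + C := by
  obtain ⟨gate, hg⟩ := M.exists_isGate
  obtain ⟨K, hK, -⟩ := (M.guessedGeodesics hg).exists_close M.connected
  refine ⟨2 * δ + 1 + K, by positivity, fun o a b => ?_⟩
  obtain ⟨w, hw, hwd⟩ := hδ.exists_dist_le hΔ o a b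
  have hwL : ι w ∈ gatePath Γ T τ gate (ι a) (ι b) := by
    have h := fun c => (hι.tau c).trans (hι.tau w).symm
    refine ⟨by rw [h a]; exact left_mem_interval _ _, ?_⟩
    rw [gateProj_of_eq (h a), gateProj_of_eq (h b)]
    exact (hι.mem_interval_iff hΔ).2 hw
  obtain ⟨v, hv, hvd⟩ := hK _ _ _ hwL
  have h₁ := gromovProduct_le_dist_of_mem M.connected (o := ι o) hv
  have h₂ := dist_triangle_cast M.connected (ι o) (ι w) v
  have h₃ : (Γ.dist (ι o) (ι w) : ℝ) ≤ Δ.dist o w := by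
    have := M.dist_le_fibre_dist ((hι.tau o).trans (hι.tau w).symm)
    rw [hι.dist_eq hΔ] at this
    exact_mod_cast this
  have h₄ : (Γ.dist (ι w) v : ℝ) ≤ K := by exact_mod_cast hvd
  linarith

/-- The converse comparison: geodesics of `Γ` stay close to the fibre interval. Here distances of
`Γ` are turned into fibre distances, which costs the distortion factor `N + 1`. -/
theorem isGromovProper_piece (M : TreeOfGraphs Γ T τ N δ)
    (hι : IsPiece Δ Γ τ t ι) (hΔ : Δ.Connected) :
    IsGromovProper Δ Γ ι := by
  obtain ⟨gate, hg⟩ := M.exists_isGate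
  obtain ⟨K, -, hK⟩ := (M.guessedGeodesics hg).exists_close M.connected
  obtain ⟨δ', hδ'⟩ := M.thinIntervals
  refine ⟨(N + 1) * (2 * δ' + 1 + K + 1), by positivity, fun o a b => ?_⟩
  obtain ⟨v, hv, hvd⟩ := hδ'.exists_dist_le M.connected (ι o) (ι a) (ι b)
  obtain ⟨w, hw, hwd⟩ := hK _ _ v hv
  have hwt : τ w = t := by
    have := hw.1
    rw [hι.tau, hι.tau] at this
    exact eq_of_mem_interval_self (M.isTree.1.preconnected _ _) this
  have hwI := hw.2
  rw [gateProj_of_eq ((hι.tau a).trans hwt.symm), gateProj_of_eq ((hι.tau b).trans hwt.symm)]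
    at hwI
  obtain ⟨c, rfl⟩ := hι.exists_eq w hwt
  have h₁ := gromovProduct_le_dist_of_mem hΔ (o := o) ((hι.mem_interval_iff hΔ).1 hwI)
  have h₂ : (Δ.dist o c : ℝ) ≤ (N + 1) * Γ.dist (ι o) (ι c) := by
    have := M.fibre_dist_le ((hι.tau o).trans (hι.tau c).symm)
    rw [hι.dist_eq hΔ] at this
    exact_mod_cast this
  have h₃ := dist_triangle_cast M.connected (ι o) v (ι c)
  have h₄ : (Γ.dist v (ι c) : ℝ) ≤ K := by exact_mod_cast hwd
  have h₅ := gromovProduct_nonneg M.connected (ι o) (ι a) (ι b)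
  have h₆ : (N + 1 : ℝ) * Γ.dist (ι o) (ι c) ≤
      (N + 1) * (gromovProduct Γ (ι o) (ι a) (ι b) + (2 * δ' + 1) + K) :=
    mul_le_mul_of_nonneg_left (by linarith) (by positivity)
  have h₇ : 0 ≤ (N + 1 : ℝ) * (2 * δ' + 1 + K) * gromovProduct Γ (ι o) (ι a) (ι b) :=
    mul_nonneg (by positivity) h₅
  have h₈ : (0 : ℝ) ≤ N + 1 := by positivity
  calc gromovProduct Δ o a b ≤ _ := h₁.trans (h₂.trans h₆)
    _ ≤ _ := by linarith

/-- A shortest path from `v` to another vertex of the fibre over `t` soon meets that fibre again. -/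
theorem exists_mem_interval_fibre (M : TreeOfGraphs Γ T τ N δ)
    (hg : IsGate Γ T τ gate) {v y : X} (hy : τ y = t)
    (hne : v ≠ y) : ∃ v', v' ≠ v ∧ τ v' = t ∧ v' ∈ interval Γ v y ∧
      (fibreGraph Γ τ).dist (gateProj T τ gate t v) v' ≤ N + 1 := by
  by_cases hv : τ v = t
  · rw [gateProj_of_eq hv]
    obtain ⟨z, hz, hzI⟩ := exists_adj_mem_interval M.connected hne
    by_cases hzt : τ z = t
    · refine ⟨z, hz.ne', hzt, hzI, ?_⟩
      have : (fibreGraph Γ τ).Adj v z := ⟨hz, hv.trans hzt.symm⟩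
      rw [SimpleGraph.dist_eq_one_iff_adj.2 this]
      omega
    · have hτ : τ v ≠ τ z := fun h => hzt (h.symm.trans hv)
      have hadj := (M.adj hz).resolve_left hτ
      rw [hv] at hadj
      -- A path leaving the fibre at `v` must return over the same tree edge, hence within `N` of
      -- `v`; the return vertex differs from `v` because the path is shortest.
      obtain ⟨p, q, hpq, hp, hq, hpI, -⟩ := M.exists_crossing (x := y) (y := z)
        (by rw [hy, toward_self]; exact hadj.ne) (toward_of_adj M.isTree hadj) hadj
      rw [mem_interval_comm] at hpI
      refine ⟨p, ?_, hp, (mem_interval_trans M.connected hzI hpI).1, ?_⟩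
      · rintro rfl
        have h₁ : Γ.dist z p + Γ.dist p y = Γ.dist z y := hpI
        have h₂ : Γ.dist p z + Γ.dist z y = Γ.dist p y := hzI
        have h₃ := SimpleGraph.dist_eq_one_iff_adj.2 hz
        omega
      · exact (M.adhesion hz hpq (hv.trans hp.symm) hq.symm hτ).trans (Nat.le_succ N)
  · rw [gateProj_of_ne hv]
    have hadj := (toward_spec M.isTree hv).1
    obtain ⟨p, q, hpq, hp, hq, hpI, -⟩ := M.exists_crossing (x := y) (y := v)
      (by rw [hy, toward_self]; exact hadj.ne) rfl hadj
    refine ⟨p, fun h => hv (by rw [← h, hp]), hp, mem_interval_comm.1 hpI, ?_⟩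
    obtain ⟨h₁, h₂⟩ := hg _ _ hadj
    obtain ⟨h₃, -⟩ := hg _ _ hadj.symm
    refine (M.adhesion h₂ hpq (h₁.trans hp.symm) (h₃.trans hq.symm) ?_).trans (Nat.le_succ N)
    rw [h₁, h₃]
    exact hadj.ne

/-- Gromov sequences in a fibre converge to rays. -/
theorem exists_ray_of_fibre (M : TreeOfGraphs Γ T τ N δ)
    {y : ℕ → X} (hy : IsGromovSequence Γ y) (hτ : ∀ n, τ (y n) = t) :
    ∃ s : GeodesicRay Γ, CoConvergent Γ y s.vertex := by
  obtain ⟨gate, hg⟩ := M.exists_isGate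
  obtain ⟨δ', hδ'⟩ := M.thinIntervals
  obtain ⟨s, hs₀, hs⟩ := exists_ray_of_infinite M.connected (y 0) y fun v hv => by
    -- All shortest paths from `v` to the sequence pass through this finite ball after leaving `v`,
    -- so infinitely many of them share a vertex.
    have hfin := M.finite (gateProj T τ gate t v) (N + 1)
    rw [hg.tau_gateProj M.isTree] at hfin
    obtain ⟨v', hv', hinf⟩ := exists_infinite_of_finite hv hfin
      (R := fun n v' => v' ≠ v ∧ v' ∈ interval Γ v (y n)) (by
        filter_upwards [hy.eventually_ne v] with n hn _
        obtain ⟨v', h₁, h₂, h₃, h₄⟩ := M.exists_mem_interval_fibre hg (hτ n) hn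
        exact ⟨v', ⟨h₂, h₄⟩, h₁, h₃⟩)
    obtain ⟨n, hn, hne, hI⟩ := hinf.nonempty
    exact ⟨v', hne, (mem_interval_trans M.connected hn hI).2,
      hinf.mono fun n hn => (mem_interval_trans M.connected hn.1 hn.2.2).1⟩
  exact ⟨s, coConvergent_of_infinite M.connected (hδ'.fourPoint M.connected) (by positivity) hy
    (by rwa [hs₀])⟩

/-- Gromov sequences along a ray of the tree converge to rays. -/
theorem exists_ray_of_tree_ray (M : TreeOfGraphs Γ T τ N δ)
    {y : ℕ → X} (hy : IsGromovSequence Γ y) (r : GeodesicRay T)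
    (hτ : ∀ n, τ (y n) = r.vertex n) : ∃ s : GeodesicRay Γ, CoConvergent Γ y s.vertex := by
  obtain ⟨gate, hg⟩ := M.exists_isGate
  obtain ⟨δ', hδ'⟩ := M.thinIntervals
  obtain ⟨s, hs₀, hs⟩ := exists_ray_of_infinite M.connected (y 0) y fun v hv => by
    -- So far out, `v` lies before the edge from `r.vertex m` to `r.vertex (m + 1)` and all late `y
    -- n` beyond it; every shortest path between them crosses in a finite set.
    set m := T.dist (r.vertex 0) (τ v) + 1 with hm
    have hadj := r.adj_succ m
    have hvside : toward T (r.vertex m) (τ v) ≠ r.vertex (m + 1) := by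
      intro h
      have h₁ : T.dist (r.vertex 0) (r.vertex m) + T.dist (r.vertex m) (τ v) =
        T.dist (r.vertex 0) (τ v) := r.mem_interval_of_toward_eq M.isTree h
      rw [r.dist_zero] at h₁
      omega
    obtain ⟨h₁, h₂⟩ := hg _ _ hadj.symm
    obtain ⟨h₃, -⟩ := hg _ _ hadj
    have hfin := M.finite (gate (r.vertex (m + 1)) (r.vertex m)) N
    rw [h₁] at hfin
    obtain ⟨v', hv', hinf⟩ := exists_infinite_of_finite hv hfin
      (R := fun n v' => v' ∈ interval Γ v (y n)) (by
        filter_upwards [eventually_gt_atTop m] with n hn _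
        obtain ⟨p, q, hpq, hp, hq, -, hqI⟩ := M.exists_crossing (x := v) (y := y n) hvside
          (by rw [hτ, r.toward_vertex M.isTree hn]) hadj
        refine ⟨q, ⟨hq, ?_⟩, hqI⟩
        refine M.adhesion h₂ hpq.symm (h₁.trans hq.symm) (h₃.trans hp.symm) ?_
        rw [h₁, h₃]
        exact hadj.ne')
    obtain ⟨n, hn, hI⟩ := hinf.nonempty
    refine ⟨v', ?_, (mem_interval_trans M.connected hn hI).2,
      hinf.mono fun n hn => (mem_interval_trans M.connected hn.1 hn.2).1⟩
    rintro rfl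
    exact hvside (by rw [hv'.1, toward_of_adj M.isTree hadj])
  exact ⟨s, coConvergent_of_infinite M.connected (hδ'.fourPoint M.connected) (by positivity) hy
    (by rwa [hs₀])⟩

end TreeOfGraphs

namespace IsGromovProper

theorem isGromovSequence (hι : IsGromovProper Δ Γ ι)
    [Nonempty Y] (hΓ : Γ.Connected) {x : ℕ → Y} (hx : IsGromovSequence Δ x) :
    IsGromovSequence Γ (ι ∘ x) := by
  obtain ⟨C, hC, h⟩ := hι
  obtain ⟨o⟩ := ‹Nonempty Y›
  refine .of_base hΓ (ι o) fun B => ?_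
  obtain ⟨n, hn⟩ := hx o (C * B + C)
  refine ⟨n, fun i hi j hj => ?_⟩
  have := (hn i hi j hj).trans (h o (x i) (x j))
  exact le_of_mul_le_mul_left (by simpa using this) hC

theorem coConvergent (hι : IsGromovProper Δ Γ ι)
    [Nonempty Y] (hΓ : Γ.Connected) {x y : ℕ → Y} (hx : CoConvergent Δ x y) :
    CoConvergent Γ (ι ∘ x) (ι ∘ y) := by
  obtain ⟨C, hC, h⟩ := hι
  obtain ⟨o⟩ := ‹Nonempty Y›
  refine .of_base hΓ (ι o) ?_
  rw [tendsto_atTop]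
  intro B
  filter_upwards [(hx o).eventually_ge_atTop (C * B + C)] with i hi
  have := hi.trans (h o (x i) (y i))
  exact le_of_mul_le_mul_left (by simpa using this) hC

end IsGromovProper

namespace TreeOfGraphs

/-- A ray that visits a piece infinitely often is a limit of a ray of that piece. -/
theorem exists_piece_ray (M : TreeOfGraphs Γ T τ N δ)
    (hι : IsPiece Δ Γ τ t ι) (hΔ : Δ.Connected) (hfin : IsLocallyFinite Δ)
    (s : GeodesicRay Γ) (hs : {n | τ (s.vertex n) = t}.Infinite) :
    ∃ r : GeodesicRay Δ, CoConvergent Γ (ι ∘ r.vertex) s.vertex := by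
  obtain ⟨δ', hδ'⟩ := M.thinIntervals
  have := hΔ.nonempty
  have hφ : ∀ n, τ (s.vertex (Nat.nth (fun n => τ (s.vertex n) = t) n)) = t :=
    fun n => Nat.nth_mem_of_infinite hs n
  have hmono := Nat.nth_strictMono (p := fun n => τ (s.vertex n) = t) hs
  set φ := Nat.nth (fun n => τ (s.vertex n) = t)
  choose y hy using fun n => hι.exists_eq _ (hφ n)
  have hinj : Function.Injective y := by
    intro i j hij
    have h₁ : s.vertex (φ i) = s.vertex (φ j) := by rw [← hy, ← hy, hij]
    have h₂ : φ i = φ j := by rw [← s.dist_zero (φ i), ← s.dist_zero (φ j), h₁]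
    exact hmono.injective h₂
  -- The vertices where `s` visits the piece are distinct, so local finiteness of the piece yields a
  -- ray `r` towards them. Properness of `ι` then makes the products of `r` with these visits large
  -- in `Γ` too.
  obtain ⟨r, hr₀, hr⟩ := exists_ray_of_locallyFinite hΔ hfin (y 0) hinj
  refine ⟨r, ?_⟩
  have hprop := M.isGromovProper_piece hι hΔ
  refine (hprop.isGromovSequence M.connected (r.isGromovSequence hΔ)).coConvergent M.connected
    (hδ'.fourPoint M.connected) (by positivity) (s.isGromovSequence M.connected) (ι (y 0))
    fun B n => ?_
  obtain ⟨C, hC, hle⟩ := hprop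
  set k := max ⌈C * B + C⌉₊ n with hk
  obtain ⟨j, hj, hnj⟩ := (hr k).exists_gt n
  refine ⟨k, le_max_right _ _, φ j, hnj.le.trans hmono.le_apply, ?_⟩
  have h₁ := hle (y 0) (r.vertex k) (y j)
  rw [gromovProduct_eq_dist_of_mem hj, ← hr₀, r.dist_zero, hr₀, hy j] at h₁
  have h₂ : C * B + C ≤ k := (Nat.le_ceil _).trans (by exact_mod_cast le_max_left _ _)
  exact le_of_mul_le_mul_left (by simpa using h₂.trans h₁) hC

/-- A ray that visits every fibre only finitely often follows a ray of the tree. -/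
theorem exists_tree_ray (M : TreeOfGraphs Γ T τ N δ)
    {σ : W → X} (hσ : ∀ a, τ (σ a) = a) (s : GeodesicRay Γ)
    (hs : ∀ t, ¬ {n | τ (s.vertex n) = t}.Infinite) :
    ∃ r : GeodesicRay T, CoConvergent Γ (σ ∘ r.vertex) s.vertex := by
  obtain ⟨δ', hδ'⟩ := M.thinIntervals
  have hne : Nonempty W := M.isTree.1.nonempty
  obtain ⟨r, hr₀, hr⟩ := exists_ray_of_infinite M.isTree.1 (τ (s.vertex 0))
    (fun n => τ (s.vertex n)) fun v hv => by
      have hev : ∀ᶠ n in atTop, τ (s.vertex n) ≠ v := by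
        rw [← Nat.cofinite_eq_atTop]
        exact (Set.not_infinite.1 (hs v)).compl_mem_cofinite
      -- `T` may have infinite degrees; the next vertex is found because the projected ray
      -- eventually stays in one direction from `v`.
      obtain ⟨b, hb, hconst⟩ := TreeAmalgam.eventually_toward_eq M.isTree
        (t := fun n => τ (s.vertex n)) (fun n => M.adj (s.adj_succ n)) hev
      obtain ⟨b', rfl, hinf⟩ := exists_infinite_of_finite hv (Set.finite_singleton b)
        (R := fun n b => b ∈ interval T v (τ (s.vertex n))) (by
          filter_upwards [hconst, hev] with n h₁ h₂ _
          exact ⟨b, rfl, h₁ ▸ (toward_spec M.isTree h₂).2⟩)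
      obtain ⟨n, hn, hI⟩ := hinf.nonempty
      exact ⟨b', hb.ne', (mem_interval_trans M.isTree.1 hn hI).2,
        hinf.mono fun n hn => (mem_interval_trans M.isTree.1 hn.1 hn.2).1⟩
  refine ⟨r, ?_⟩
  refine ((M.isGromovProper_section hσ).isGromovSequence M.connected
    (r.isGromovSequence M.isTree.1)).coConvergent M.connected
    (hδ'.fourPoint M.connected) (by positivity) (s.isGromovSequence M.connected) (s.vertex 0)
    fun B n => ?_
  obtain ⟨C, hC, hle⟩ := M.tree_gromovProduct_le
  set k := max ⌈B + C⌉₊ n with hk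
  obtain ⟨j, hj, hnj⟩ := (hr k).exists_gt n
  refine ⟨k, le_max_right _ _, j, hnj.le, ?_⟩
  have h₁ := hle (s.vertex 0) (σ (r.vertex k)) (s.vertex j)
  rw [hσ, gromovProduct_eq_dist_of_mem hj, ← hr₀, r.dist_zero] at h₁
  have h₂ : B + C ≤ k := (Nat.le_ceil _).trans (by exact_mod_cast le_max_left _ _)
  simp only [Function.comp_apply]
  linarith

end TreeOfGraphs

end Pieces

/-! ### Induced maps between boundaries -/

section BoundaryMap

variable {X Y : Type*} {Γ : SimpleGraph X} {Δ : SimpleGraph Y} {ι : Y → X} {δ ε : ℕ}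

/-- The map `F` between the boundaries is induced by the map `ι` between the vertex sets. -/
def Induces (ι : Y → X) (F : Boundary Δ → Boundary Γ) : Prop :=
  ∀ (r : GeodesicRay Δ) (s : GeodesicRay Γ), s.point = F r.point →
    CoConvergent Γ (ι ∘ r.vertex) s.vertex

theorem IsGromovProper.exists_induces (hι : IsGromovProper Δ Γ ι) (hΓ : Γ.Connected)
    (hΔ : Δ.Connected) (hδ : ThinIntervals Γ δ) (hε : ThinIntervals Δ ε)
    (hrays : ∀ r : GeodesicRay Δ, ∃ s : GeodesicRay Γ, CoConvergent Γ (ι ∘ r.vertex) s.vertex) :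
    ∃ F : Boundary Δ → Boundary Γ, Induces ι F := by
  have := hΔ.nonempty
  choose S hS using hrays
  choose R hR using fun ξ : Boundary Δ => exists_point_eq ξ
  refine ⟨fun ξ => (S (R ξ)).point, fun r s hs => ?_⟩
  have h4 := hδ.fourPoint hΓ
  have h₁ : CoConvergent Δ r.vertex (R r.point).vertex :=
    (GeodesicRay.point_eq_iff hΔ (hε.fourPoint hΔ) (by positivity)).1 (hR r.point).symm
  have h₂ := (GeodesicRay.point_eq_iff hΓ h4 (by positivity)).1 hs
  exact ((hι.coConvergent hΓ h₁).trans h4 (hS _)).trans h4 h₂.symm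

variable {F : Boundary Δ → Boundary Γ}

theorem Induces.convergesTo (hF : Induces ι F) (hι : IsGromovProper Δ Γ ι) (hΓ : Γ.Connected)
    (hΔ : Δ.Connected) (hδ : ThinIntervals Γ δ) (hε : ThinIntervals Δ ε) {x : ℕ → Y}
    {η : Boundary Δ} (hx : ConvergesTo Δ x η) : ConvergesTo Γ (ι ∘ x) (F η) := by
  have := hΔ.nonempty
  obtain ⟨r, rfl⟩ := exists_point_eq η
  obtain ⟨s, hs⟩ := exists_point_eq (F r.point)
  rw [← hs, convergesTo_iff hΓ hδ]
  rw [convergesTo_iff hΔ hε] at hx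
  exact (hι.coConvergent hΓ hx).trans (hδ.fourPoint hΓ) (hF r s hs)

theorem GeodesicRay.convergesTo_point (hΓ : Γ.Connected) (hδ : ThinIntervals Γ δ)
    (r : GeodesicRay Γ) : ConvergesTo Γ r.vertex r.point :=
  (convergesTo_iff hΓ hδ).2 (r.isGromovSequence hΓ).coConvergent_self

theorem ConvergesTo.unique (hΓ : Γ.Connected) (hδ : ThinIntervals Γ δ) {x : ℕ → X}
    {ξ η : Boundary Γ} (hξ : ConvergesTo Γ x ξ) (hη : ConvergesTo Γ x η) : ξ = η := by
  obtain ⟨r, rfl⟩ := exists_point_eq ξ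
  obtain ⟨s, rfl⟩ := exists_point_eq η
  rw [convergesTo_iff hΓ hδ] at hξ hη
  exact (GeodesicRay.point_eq_iff hΓ (hδ.fourPoint hΓ) (by positivity)).2
    (hξ.symm.trans (hδ.fourPoint hΓ) hη)

theorem near_self (hΓ : Γ.Connected) (o : X) (n : ℕ) (ξ : Boundary Γ) : Near Γ o n ξ ξ := by
  obtain ⟨r, rfl⟩ := exists_point_eq ξ
  exact ⟨r, r, rfl, rfl, r.isGromovSequence hΓ o n⟩

theorem isOpen_boundary_iff {O : Set (Boundary Γ)} :
    IsOpen O ↔ ∀ ξ ∈ O, ∀ o : X, ∃ n : ℕ, ∀ η, Near Γ o n ξ η → η ∈ O := Iff.rfl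

theorem Induces.continuous (hF : Induces ι F) (hι : IsGromovProper Δ Γ ι) (hΓ : Γ.Connected)
    (hΔ : Δ.Connected) (hδ : ThinIntervals Γ δ) (hε : ThinIntervals Δ ε) : Continuous F := by
  obtain ⟨C, hC, hle⟩ := hι
  refine continuous_def.2 fun O hO => ?_
  rw [isOpen_boundary_iff] at hO ⊢
  intro η hη o
  obtain ⟨n, hn⟩ := hO (F η) hη (ι o)
  -- Passing from `Near` in `Δ` to products loses `2 * (3 * ε + 1)`, properness of `ι` costs the
  -- factor and summand `C`, and returning to `Near` in `Γ` needs `4 * (3 * δ + 1)` to spare.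
  refine ⟨⌈C * (n + 4 * (3 * δ + 1)) + C + 2 * (3 * ε + 1)⌉₊, fun η' hnear => hn _ ?_⟩
  obtain ⟨r, rfl⟩ := exists_point_eq η
  obtain ⟨r', rfl⟩ := exists_point_eq η'
  obtain ⟨s, hs⟩ := exists_point_eq (F r.point)
  obtain ⟨s', hs'⟩ := exists_point_eq (F r'.point)
  have h₁ := hnear.eventually_le hΔ (hε.fourPoint hΔ) (by positivity)
    (r.isGromovSequence hΔ).coConvergent_self (r'.isGromovSequence hΔ).coConvergent_self
  rw [← hs, ← hs']
  refine near_of_eventually_le hΓ (hδ.fourPoint hΓ) (by positivity) (hF r s hs) (hF r' s' hs') ?_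
  filter_upwards [h₁] with i hi
  have h₂ := Nat.le_ceil (C * (n + 4 * (3 * δ + 1)) + C + 2 * (3 * ε + 1))
  have h₃ := hle o (r.vertex i) (r'.vertex i)
  exact le_of_mul_le_mul_left (by simp only [Function.comp_apply]; linarith) hC

section Expanding

variable {C : ℝ}

theorem Induces.injective
    (hle : ∀ o a b, gromovProduct Γ (ι o) (ι a) (ι b) ≤ gromovProduct Δ o a b + C)
    (hF : Induces ι F) (hΓ : Γ.Connected) (hΔ : Δ.Connected)
    (hδ : ThinIntervals Γ δ) (hε : ThinIntervals Δ ε) : Function.Injective F := by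
  intro η η' h
  obtain ⟨o⟩ := hΔ.nonempty
  obtain ⟨r, rfl⟩ := exists_point_eq η
  obtain ⟨r', rfl⟩ := exists_point_eq η'
  obtain ⟨s, hs⟩ := exists_point_eq (F r.point)
  have h₁ := (hF r s hs).trans (hδ.fourPoint hΓ) (hF r' s (hs.trans h)).symm
  refine (GeodesicRay.point_eq_iff hΔ (hε.fourPoint hΔ) (by positivity)).2 (.of_base hΔ o ?_)
  refine tendsto_atTop_mono (fun i => ?_) (tendsto_atTop_add_const_right _ (-C) (h₁ (ι o)))
  have := hle o (r.vertex i) (r'.vertex i)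
  simp only [Function.comp_apply]
  linarith

theorem Induces.exists_near
    (hle : ∀ o a b, gromovProduct Γ (ι o) (ι a) (ι b) ≤ gromovProduct Δ o a b + C)
    (hF : Induces ι F) (hΓ : Γ.Connected) (hΔ : Δ.Connected)
    (hδ : ThinIntervals Γ δ) (hε : ThinIntervals Δ ε) (o : Y) (n : ℕ) :
    ∃ m, ∀ η η', Near Γ (ι o) m (F η) (F η') → Near Δ o n η η' := by
  refine ⟨⌈n + 4 * (3 * ε + 1) + C + 2 * (3 * δ + 1)⌉₊, fun η η' hnear => ?_⟩
  obtain ⟨r, rfl⟩ := exists_point_eq η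
  obtain ⟨r', rfl⟩ := exists_point_eq η'
  obtain ⟨s, hs⟩ := exists_point_eq (F r.point)
  obtain ⟨s', hs'⟩ := exists_point_eq (F r'.point)
  rw [← hs, ← hs'] at hnear
  have h₁ := hnear.eventually_le hΓ (hδ.fourPoint hΓ) (by positivity) (hF r s hs) (hF r' s' hs')
  refine near_of_eventually_le hΔ (hε.fourPoint hΔ) (by positivity)
    (r.isGromovSequence hΔ).coConvergent_self (r'.isGromovSequence hΔ).coConvergent_self ?_
  filter_upwards [h₁] with i hi
  have h₂ := Nat.le_ceil (n + 4 * (3 * ε + 1) + C + 2 * (3 * δ + 1))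
  have h₃ := hle o (r.vertex i) (r'.vertex i)
  simp only [Function.comp_apply] at hi
  linarith

/-- No compactness is needed: on the range, neighbourhoods pull back to neighbourhoods by
`exists_near`, and off the range closedness of the range gives a neighbourhood missing it
altogether. -/
theorem Induces.isClosedMap
    (hle : ∀ o a b, gromovProduct Γ (ι o) (ι a) (ι b) ≤ gromovProduct Δ o a b + C)
    (hF : Induces ι F) (hΓ : Γ.Connected) (hΔ : Δ.Connected)
    (hδ : ThinIntervals Γ δ) (hε : ThinIntervals Δ ε) (hrange : IsClosed (Set.range F)) :
    IsClosedMap F := by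
  intro K hK
  rw [← isOpen_compl_iff, isOpen_boundary_iff]
  intro ξ hξ o
  by_cases hmem : ξ ∈ Set.range F
  · obtain ⟨η, rfl⟩ := hmem
    obtain ⟨o'⟩ := hΔ.nonempty
    have hη : η ∈ Kᶜ := fun h => hξ ⟨η, h, rfl⟩
    obtain ⟨n, hn⟩ := isOpen_boundary_iff.1 hK.isOpen_compl η hη o'
    obtain ⟨m, hm⟩ := hF.exists_near hle hΓ hΔ hδ hε o' n
    refine ⟨m + Γ.dist o (ι o'), ?_⟩
    rintro _ hnear ⟨η', hη', rfl⟩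
    exact hn η' (hm η η' (hnear.base_change hΓ le_rfl)) hη'
  · obtain ⟨n, hn⟩ := isOpen_boundary_iff.1 hrange.isOpen_compl ξ hmem o
    refine ⟨n, ?_⟩
    rintro _ hnear ⟨η', -, rfl⟩
    exact hn _ hnear ⟨η', rfl⟩

end Expanding

/-- A closed embedding whose range contains the component of each of its points preserves
components. -/
theorem connectedComponent_eq_image {α β : Type*} [TopologicalSpace α] [TopologicalSpace β]
    {F : α → β} (hcont : Continuous F) (hinj : Function.Injective F) (hclosed : IsClosedMap F)
    (η : α) (hsub : connectedComponent (F η) ⊆ Set.range F) :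
    connectedComponent (F η) = F '' connectedComponent η := by
  have hemb : Topology.IsClosedEmbedding F :=
    Topology.IsClosedEmbedding.of_continuous_injective_isClosedMap hcont hinj hclosed
  apply subset_antisymm
  · have h₁ : F '' (F ⁻¹' connectedComponent (F η)) = connectedComponent (F η) :=
      Set.image_preimage_eq_of_subset hsub
    have h₂ : IsPreconnected (F ⁻¹' connectedComponent (F η)) := by
      rw [← hemb.isInducing.isPreconnected_image, h₁]
      exact isPreconnected_connectedComponent
    rw [← h₁]
    exact Set.image_mono (h₂.subset_connectedComponent mem_connectedComponent)
  · exact (isPreconnected_connectedComponent.image F hcont.continuousOn).subset_connectedComponent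
      ⟨η, mem_connectedComponent, rfl⟩

end BoundaryMap

/-! ### Sides of edges of the tree -/

section Sides

variable {X W : Type*} {Γ : SimpleGraph X} {T : SimpleGraph W} {τ : X → W} {N δ : ℕ}

/-- The boundary points beyond the edge `ab`, on the side of `b`. -/
def farSide (Γ : SimpleGraph X) (T : SimpleGraph W) (τ : X → W) (a b : W) : Set (Boundary Γ) :=
  {ξ | ∃ y, ConvergesTo Γ y ξ ∧ ∀ᶠ i in atTop, toward T a (τ (y i)) = b}

/-- The boundary points before the edge `ab`, on the side of `a`. -/
def nearSide (Γ : SimpleGraph X) (T : SimpleGraph W) (τ : X → W) (a b : W) : Set (Boundary Γ) :=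
  {ξ | ∃ y, ConvergesTo Γ y ξ ∧ ∀ᶠ i in atTop, toward T a (τ (y i)) ≠ b}

/-- The boundary point is the limit of a sequence over the sequence `ρ` in the tree. -/
def Follows (Γ : SimpleGraph X) (τ : X → W) (ξ : Boundary Γ) (ρ : ℕ → W) : Prop :=
  ∃ y, ConvergesTo Γ y ξ ∧ ∀ n, τ (y n) = ρ n

namespace TreeOfGraphs

/-- Gromov products across the edge have a common bound, so one `n` works for all pairs; this
uniformity makes both sides open. -/
theorem exists_not_near (M : TreeOfGraphs Γ T τ N δ) {a b : W} (hab : T.Adj a b) (o : X) :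
    ∃ n, ∀ ξ ∈ nearSide Γ T τ a b, ∀ ξ' ∈ farSide Γ T τ a b,
      ¬ Near Γ o n ξ ξ' ∧ ¬ Near Γ o n ξ' ξ := by
  obtain ⟨δ', hδ'⟩ := M.thinIntervals
  have h4 := hδ'.fourPoint M.connected
  obtain ⟨C, hC⟩ := M.exists_gromovProduct_le hab o
  refine ⟨⌈C + 2 * (3 * δ' + 1) + 1⌉₊, ?_⟩
  rintro ξ ⟨y, hy, hyside⟩ ξ' ⟨y', hy', hyside'⟩
  obtain ⟨s, rfl⟩ := exists_point_eq ξ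
  obtain ⟨s', rfl⟩ := exists_point_eq ξ'
  rw [convergesTo_iff M.connected hδ'] at hy hy'
  have hceil := Nat.le_ceil (C + 2 * (3 * δ' + 1) + 1)
  constructor
  · intro hnear
    obtain ⟨i, h₁, h₂, h₃⟩ := ((hnear.eventually_le M.connected h4 (by positivity) hy hy').and
      (hyside.and hyside')).exists
    have := hC _ _ h₂ h₃
    linarith
  · intro hnear
    obtain ⟨i, h₁, h₂, h₃⟩ := ((hnear.eventually_le M.connected h4 (by positivity) hy' hy).and
      (hyside.and hyside')).exists
    have := hC _ _ h₂ h₃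
    rw [gromovProduct_comm] at this
    linarith

/-- A ray changing sides infinitely often would have bounded Gromov products between arbitrarily
late vertices. -/
theorem mem_nearSide_or_mem_farSide (M : TreeOfGraphs Γ T τ N δ)
    {a b : W} (hab : T.Adj a b) (ξ : Boundary Γ) :
    ξ ∈ nearSide Γ T τ a b ∨ ξ ∈ farSide Γ T τ a b := by
  obtain ⟨δ', hδ'⟩ := M.thinIntervals
  obtain ⟨s, rfl⟩ := exists_point_eq ξ
  have hs := s.convergesTo_point M.connected hδ'
  by_contra! h
  have h₁ : ∃ᶠ i in atTop, toward T a (τ (s.vertex i)) = b := fun h' => h.1 ⟨_, hs, h'⟩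
  have h₂ : ∃ᶠ i in atTop, toward T a (τ (s.vertex i)) ≠ b := fun h' =>
    h.2 ⟨_, hs, h'.mono fun i hi => not_not.1 hi⟩
  obtain ⟨C, hC⟩ := M.exists_gromovProduct_le hab (s.vertex 0)
  obtain ⟨n, hn⟩ := s.isGromovSequence M.connected (s.vertex 0) (C + 1)
  obtain ⟨i, hi, hin⟩ := (h₁.and_eventually (eventually_ge_atTop n)).exists
  obtain ⟨j, hj, hjn⟩ := (h₂.and_eventually (eventually_ge_atTop n)).exists
  have h₃ := hC _ _ hj hi
  have h₄ := hn j hjn i hin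
  linarith

theorem notMem_nearSide (M : TreeOfGraphs Γ T τ N δ) {a b : W} (hab : T.Adj a b) {ξ : Boundary Γ}
    (h : ξ ∈ farSide Γ T τ a b) : ξ ∉ nearSide Γ T τ a b := by
  intro h'
  obtain ⟨o⟩ := M.connected.nonempty
  obtain ⟨n, hn⟩ := M.exists_not_near hab o
  exact (hn ξ h' ξ h).1 (near_self M.connected o n ξ)

theorem isClopen_farSide (M : TreeOfGraphs Γ T τ N δ)
    {a b : W} (hab : T.Adj a b) : IsClopen (farSide Γ T τ a b) := by
  constructor
  · rw [← isOpen_compl_iff, isOpen_boundary_iff]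
    intro ξ hξ o
    obtain ⟨n, hn⟩ := M.exists_not_near hab o
    have hξ := (M.mem_nearSide_or_mem_farSide hab ξ).resolve_right hξ
    exact ⟨n, fun η hnear hη => (hn ξ hξ η hη).1 hnear⟩
  · rw [isOpen_boundary_iff]
    intro ξ hξ o
    obtain ⟨n, hn⟩ := M.exists_not_near hab o
    exact ⟨n, fun η hnear => (M.mem_nearSide_or_mem_farSide hab η).resolve_left
      fun hη => (hn η hη ξ hξ).2 hnear⟩

theorem exists_isClopen_of_eventually (M : TreeOfGraphs Γ T τ N δ)
    {ξ : Boundary Γ} {ρ : ℕ → W} (hξ : Follows Γ τ ξ ρ)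
    {a b : W} (hab : T.Adj a b) (hρ : ∀ᶠ n in atTop, toward T a (ρ n) = b) :
    ∃ O, IsClopen O ∧ ξ ∈ O ∧ ∀ ξ' ρ', Follows Γ τ ξ' ρ' →
      (∀ᶠ n in atTop, toward T a (ρ' n) ≠ b) → ξ' ∉ O := by
  refine ⟨farSide Γ T τ a b, M.isClopen_farSide hab, ?_, ?_⟩
  · obtain ⟨y, hy, hτ⟩ := hξ
    exact ⟨y, hy, by simpa only [hτ] using hρ⟩
  · rintro ξ' ρ' ⟨y, hy, hτ⟩ hρ' hmem
    exact M.notMem_nearSide hab hmem ⟨y, hy, by simpa only [hτ] using hρ'⟩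

/-- Boundary points of the fibre over `a` are separated from all other boundary points. -/
theorem exists_isClopen_of_fibre (M : TreeOfGraphs Γ T τ N δ)
    {ξ : Boundary Γ} {ρ : ℕ → W} (hξ : Follows Γ τ ξ ρ) {a : W}
    (hρ : ∃ b, T.Adj a b ∧ ∀ᶠ n in atTop, toward T a (ρ n) = b) :
    ∃ O, IsClopen O ∧ ξ ∈ O ∧ ∀ ξ', Follows Γ τ ξ' (fun _ => a) → ξ' ∉ O := by
  obtain ⟨b, hab, hρ⟩ := hρ
  obtain ⟨O, h₁, h₂, h₃⟩ := M.exists_isClopen_of_eventually hξ hab hρ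
  exact ⟨O, h₁, h₂, fun ξ' hξ' => h₃ ξ' _ hξ'
    (Eventually.of_forall fun _ => by rw [toward_self]; exact hab.ne)⟩

theorem exists_isClopen_fibre_fibre (M : TreeOfGraphs Γ T τ N δ)
    {ξ : Boundary Γ} {a a' : W} (h : a' ≠ a)
    (hξ : Follows Γ τ ξ (fun _ => a')) :
    ∃ O, IsClopen O ∧ ξ ∈ O ∧ ∀ ξ', Follows Γ τ ξ' (fun _ => a) → ξ' ∉ O :=
  M.exists_isClopen_of_fibre hξ ⟨_, (toward_spec M.isTree h).1, Eventually.of_forall fun _ => rfl⟩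

theorem exists_isClopen_ray_fibre (M : TreeOfGraphs Γ T τ N δ)
    {ξ : Boundary Γ} (r : GeodesicRay T) (a : W)
    (hξ : Follows Γ τ ξ r.vertex) :
    ∃ O, IsClopen O ∧ ξ ∈ O ∧ ∀ ξ', Follows Γ τ ξ' (fun _ => a) → ξ' ∉ O :=
  M.exists_isClopen_of_fibre hξ (r.eventually_toward_eq M.isTree a)

theorem exists_isClopen_ray_ray (M : TreeOfGraphs Γ T τ N δ)
    {ξ ξ' : Boundary Γ} {r r' : GeodesicRay T}
    (h : r.point ≠ r'.point) (hξ : Follows Γ τ ξ r.vertex) (hξ' : Follows Γ τ ξ' r'.vertex) :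
    ∃ O, IsClopen O ∧ ξ ∈ O ∧ ξ' ∉ O := by
  have h : ¬ CoConvergent T r.vertex r'.vertex := fun h' =>
    h ((GeodesicRay.point_eq_iff M.isTree.1 (.of_isTree M.isTree) zero_le_one).2 h')
  obtain ⟨m, hm⟩ := exists_eventually_toward_ne M.isTree h
  obtain ⟨O, h₁, h₂, h₃⟩ := M.exists_isClopen_of_eventually hξ (r.adj_succ m)
    ((eventually_gt_atTop m).mono fun n hn => r.toward_vertex M.isTree hn)
  exact ⟨O, h₁, h₂, h₃ ξ' _ hξ' hm⟩

end TreeOfGraphs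

end Sides

/-! ### The boundary of a tree of graphs -/

section TreeBoundary

variable {X Y W : Type*} {Γ : SimpleGraph X} {Δ : SimpleGraph Y} {T : SimpleGraph W} {τ : X → W}
  {N δ : ℕ} {t : W} {ι : Y → X} {σ : W → X}

theorem connectedComponent_subset_of_forall_isClopen {α : Type*} [TopologicalSpace α] {S : Set α}
    {ξ : α} (h : ∀ ζ, ζ ∉ S → ∃ O, IsClopen O ∧ ζ ∈ O ∧ ξ ∉ O) :
    connectedComponent ξ ⊆ S := by
  intro ζ hζ
  by_contra hζS
  obtain ⟨O, hO, h₁, h₂⟩ := h ζ hζS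
  exact hO.compl.connectedComponent_subset h₂ hζ h₁

namespace TreeOfGraphs

theorem exists_induces_piece (M : TreeOfGraphs Γ T τ N δ)
    (hι : IsPiece Δ Γ τ t ι) (hΔ : Δ.Connected)
    (hδ : ThinIntervals Δ δ) : ∃ F : Boundary Δ → Boundary Γ, Induces ι F := by
  obtain ⟨δ', hδ'⟩ := M.thinIntervals
  have := hΔ.nonempty
  have hprop := M.isGromovProper_piece hι hΔ
  exact hprop.exists_induces M.connected hΔ hδ' hδ fun r => M.exists_ray_of_fibre
    (hprop.isGromovSequence M.connected (r.isGromovSequence hΔ)) fun n => hι.tau _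

theorem exists_induces_section (M : TreeOfGraphs Γ T τ N δ) (hσ : ∀ a, τ (σ a) = a) :
    ∃ F : Boundary T → Boundary Γ, Induces σ F := by
  obtain ⟨δ', hδ'⟩ := M.thinIntervals
  have := M.isTree.1.nonempty
  have hprop := M.isGromovProper_section hσ
  exact hprop.exists_induces M.connected M.isTree.1 hδ' (thinIntervals_of_isTree M.isTree)
    fun r => M.exists_ray_of_tree_ray
      (hprop.isGromovSequence M.connected (r.isGromovSequence M.isTree.1)) r fun n => hσ _

theorem convergesTo_of_induces (M : TreeOfGraphs Γ T τ N δ)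
    {F : Boundary Δ → Boundary Γ} (hF : Induces ι F)
    (r : GeodesicRay Δ) : ConvergesTo Γ (ι ∘ r.vertex) (F r.point) := by
  obtain ⟨δ', hδ'⟩ := M.thinIntervals
  obtain ⟨s, hs⟩ := exists_point_eq (F r.point)
  rw [← hs, convergesTo_iff M.connected hδ']
  exact hF r s hs

theorem follows_fibre (M : TreeOfGraphs Γ T τ N δ)
    (hι : IsPiece Δ Γ τ t ι) {F : Boundary Δ → Boundary Γ} (hF : Induces ι F)
    (η : Boundary Δ) : Follows Γ τ (F η) (fun _ => t) := by
  obtain ⟨r, rfl⟩ := exists_point_eq η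
  exact ⟨_, M.convergesTo_of_induces hF r, fun n => hι.tau _⟩

theorem follows_ray (M : TreeOfGraphs Γ T τ N δ)
    (hσ : ∀ a, τ (σ a) = a) {F : Boundary T → Boundary Γ} (hF : Induces σ F)
    (r : GeodesicRay T) : Follows Γ τ (F r.point) r.vertex :=
  ⟨_, M.convergesTo_of_induces hF r, fun _ => hσ _⟩

theorem point_eq_of_coConvergent (M : TreeOfGraphs Γ T τ N δ)
    {F : Boundary Δ → Boundary Γ} (hF : Induces ι F)
    {r : GeodesicRay Δ} {s : GeodesicRay Γ} (h : CoConvergent Γ (ι ∘ r.vertex) s.vertex) :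
    F r.point = s.point := by
  obtain ⟨δ', hδ'⟩ := M.thinIntervals
  exact ConvergesTo.unique M.connected hδ' (M.convergesTo_of_induces hF r)
    ((convergesTo_iff M.connected hδ').2 h)

/-- Products in `T` bound those in `Γ` from below for arbitrary vertices of the fibres, so neither
the position of `z i` in its fibre nor the choice of the section matters. -/
theorem convergesTo_of_tree_convergesTo (M : TreeOfGraphs Γ T τ N δ)
    (hσ : ∀ a, τ (σ a) = a) {F : Boundary T → Boundary Γ}
    (hF : Induces σ F) {z : ℕ → X} {η : Boundary T}
    (hz : ConvergesTo T (fun i => τ (z i)) η) : ConvergesTo Γ z (F η) := by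
  obtain ⟨δ', hδ'⟩ := M.thinIntervals
  obtain ⟨o⟩ := M.connected.nonempty
  obtain ⟨r, rfl⟩ := exists_point_eq η
  obtain ⟨s, hs⟩ := exists_point_eq (F r.point)
  rw [convergesTo_iff M.isTree.1 (thinIntervals_of_isTree M.isTree)] at hz
  obtain ⟨C, hC, hle⟩ := M.tree_gromovProduct_le
  have h₁ : CoConvergent Γ z (σ ∘ r.vertex) := by
    refine .of_base M.connected o (tendsto_atTop_mono (fun i => ?_)
      (tendsto_atTop_add_const_right _ (-C) (hz (τ o))))
    have := hle o (z i) (σ (r.vertex i))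
    rw [hσ] at this
    simp only [Function.comp_apply]
    linarith
  rw [← hs, convergesTo_iff M.connected hδ']
  exact h₁.trans (hδ'.fourPoint M.connected) (hF r s hs)

/-- The separation hypothesis acts twice: it makes the range closed, so that `F` is a closed
embedding, and it keeps components of points of the range inside it. -/
theorem connectedComponent_piece (M : TreeOfGraphs Γ T τ N δ)
    (hι : IsPiece Δ Γ τ t ι) (hΔ : Δ.Connected)
    (hδ : ThinIntervals Δ δ) {F : Boundary Δ → Boundary Γ} (hF : Induces ι F)
    (hsep : ∀ ξ ∉ Set.range F, ∃ O, IsClopen O ∧ ξ ∈ O ∧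
      ∀ ξ', Follows Γ τ ξ' (fun _ => t) → ξ' ∉ O) (η : Boundary Δ) :
    connectedComponent (F η) = F '' connectedComponent η := by
  obtain ⟨δ', hδ'⟩ := M.thinIntervals
  obtain ⟨C, -, hC⟩ := M.gromovProduct_piece_le hι hΔ hδ
  have hrange : IsClosed (Set.range F) := by
    rw [← isOpen_compl_iff, isOpen_iff_forall_mem_open]
    intro ξ hξ
    obtain ⟨O, h₁, h₂, h₃⟩ := hsep ξ hξ
    refine ⟨O, ?_, h₁.isOpen, h₂⟩
    rintro _ hO ⟨η', rfl⟩
    exact h₃ _ (M.follows_fibre hι hF η') hO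
  refine connectedComponent_eq_image
    (hF.continuous (M.isGromovProper_piece hι hΔ) M.connected hΔ hδ' hδ)
    (hF.injective hC M.connected hΔ hδ' hδ)
    (hF.isClosedMap hC M.connected hΔ hδ' hδ hrange) η
    (connectedComponent_subset_of_forall_isClopen fun ξ hξ => ?_)
  obtain ⟨O, h₁, h₂, h₃⟩ := hsep ξ hξ
  exact ⟨O, h₁, h₂, h₃ _ (M.follows_fibre hι hF η)⟩

/-- The image of the boundary of `T` need not be closed, as ends of `T` can accumulate at boundary
points of a fibre. Instead, separation by clopen sets shows that the component is a single point. -/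
theorem connectedComponent_section (M : TreeOfGraphs Γ T τ N δ)
    (hσ : ∀ a, τ (σ a) = a) {F : Boundary T → Boundary Γ}
    (hF : Induces σ F) (η : Boundary T)
    (hsep : ∀ ξ, ξ ≠ F η → ∃ O, IsClopen O ∧ ξ ∈ O ∧ F η ∉ O) :
    connectedComponent (F η) = F '' connectedComponent η := by
  obtain ⟨δ', hδ'⟩ := M.thinIntervals
  have hcont := hF.continuous (M.isGromovProper_section hσ) M.connected M.isTree.1 hδ'
    (thinIntervals_of_isTree M.isTree)
  apply subset_antisymm
  · refine (connectedComponent_subset_of_forall_isClopen (S := {F η}) hsep).trans ?_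
    rw [Set.singleton_subset_iff]
    exact ⟨η, mem_connectedComponent, rfl⟩
  · exact (isPreconnected_connectedComponent.image F hcont.continuousOn).subset_connectedComponent
      ⟨η, mem_connectedComponent, rfl⟩

end TreeOfGraphs

end TreeBoundary

/-! ### Tree amalgamations as trees of graphs -/

section Amalgamation

variable {A B W : Type*} {G : SimpleGraph A} {H : SimpleGraph B} {T : SimpleGraph W} {U V : Set W}
  {p q : ℕ∞}

theorem ThinIntervals.mono {X : Type*} {Γ : SimpleGraph X} {δ ε : ℕ} (h : ThinIntervals Γ δ)
    (hle : δ ≤ ε) : ThinIntervals Γ ε := by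
  intro x y z w hw
  obtain ⟨w', h₁, h₂⟩ := h x y z w hw
  exact ⟨w', h₁, h₂.trans hle⟩

theorem IsSemiregularTree.ne (hT : IsSemiregularTree T U V p q) (u : U) (v : V) :
    (u : W) ≠ v := fun h =>
  Set.disjoint_left.1 hT.bipartite.disjoint u.2 (h ▸ v.2)

theorem isPiece_left (hT : IsSemiregularTree T U V p q) (D : Gluing A B T U V p q) (u : U) :
    IsPiece G (D.sumGraph G H) treeVertex (u : W) (fun a => Sum.inl (u, a)) where
  injective := fun a b h => by simpa using h
  tau := fun a => rfl
  exists_eq := by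
    rintro (⟨u', a⟩ | ⟨v, b⟩) h
    · obtain rfl : u' = u := Subtype.ext h
      exact ⟨a, rfl⟩
    · exact absurd h.symm (hT.ne u v)
  adj_iff := ⟨fun h => h.2, fun h => ⟨rfl, h⟩⟩

theorem isPiece_right (hT : IsSemiregularTree T U V p q) (D : Gluing A B T U V p q) (v : V) :
    IsPiece H (D.sumGraph G H) treeVertex (v : W) (fun b => Sum.inr (v, b)) where
  injective := fun a b h => by simpa using h
  tau := fun a => rfl
  exists_eq := by
    rintro (⟨u, a⟩ | ⟨v', b⟩) h
    · exact absurd h (hT.ne u v)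
    · obtain rfl : v' = v := Subtype.ext h
      exact ⟨b, rfl⟩
  adj_iff := ⟨fun h => h.2, fun h => ⟨rfl, h⟩⟩

theorem exists_newEdge (D : Gluing A B T U V p q) {u : U} {v : V}
    (h : T.Adj u v) : ∃ x y, D.NewEdge u x v y := by
  obtain ⟨x, hx⟩ := D.nonempty_left (D.label ⟨s((u : W), (v : W)), h⟩).1
  exact ⟨x, _, h, hx, rfl⟩

theorem treeOfGraphs_sumGraph (hGconn : G.Connected) (hHconn : H.Connected)
    (hGfin : IsLocallyFinite G) (hHfin : IsLocallyFinite H)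
    (hT : IsSemiregularTree T U V p q) (D : Gluing A B T U V p q) {N δ : ℕ}
    (hG : ThinIntervals G δ) (hH : ThinIntervals H δ)
    (hNG : ∀ k, ∀ x ∈ D.adhesionLeft k, ∀ y ∈ D.adhesionLeft k, G.dist x y ≤ N)
    (hNH : ∀ l, ∀ x ∈ D.adhesionRight l, ∀ y ∈ D.adhesionRight l, H.dist x y ≤ N) :
    TreeOfGraphs (D.sumGraph G H) T treeVertex N δ := by
  have hcover : ∀ t : W, t ∈ U ∨ t ∈ V := fun t => by
    have : t ∈ U ∪ V := hT.cover ▸ Set.mem_univ t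
    exact this
  have hpG := fun u : U => isPiece_left (G := G) (H := H) hT D u
  have hpH := fun v : V => isPiece_right (G := G) (H := H) hT D v
  obtain ⟨a₀⟩ := hGconn.nonempty
  obtain ⟨b₀⟩ := hHconn.nonempty
  refine ⟨hT.isTree, fun t => ?_, ?_, ?_, ?_, ?_, ?_, ?_⟩
  · rcases hcover t with h | h
    · exact ⟨Sum.inl (⟨t, h⟩, a₀), rfl⟩
    · exact ⟨Sum.inr (⟨t, h⟩, b₀), rfl⟩
  · rintro (⟨u, x⟩ | ⟨v, y⟩) (⟨u', x'⟩ | ⟨v', y'⟩) h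
    · exact Or.inl (congrArg Subtype.val h.1)
    · obtain ⟨e, -⟩ := h
      exact Or.inr e
    · obtain ⟨e, -⟩ := h
      exact Or.inr e.symm
    · exact Or.inl (congrArg Subtype.val h.1)
  · intro x y h
    rcases hcover (treeVertex y) with hy | hy
    · exact (hpG ⟨_, hy⟩).reachable hGconn h rfl
    · exact (hpH ⟨_, hy⟩).reachable hHconn h rfl
  · intro a b hab
    rcases hT.bipartite.mem_of_adj hab with ⟨ha, hb⟩ | ⟨ha, hb⟩
    · obtain ⟨x, y, h⟩ := exists_newEdge D (u := ⟨a, ha⟩) (v := ⟨b, hb⟩) hab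
      exact ⟨Sum.inl (⟨a, ha⟩, x), Sum.inr (⟨b, hb⟩, y), rfl, rfl, h⟩
    · obtain ⟨x, y, h⟩ := exists_newEdge D (u := ⟨b, hb⟩) (v := ⟨a, ha⟩) hab.symm
      exact ⟨Sum.inr (⟨a, ha⟩, y), Sum.inl (⟨b, hb⟩, x), rfl, rfl, h⟩
  · rintro (⟨u, x⟩ | ⟨v, y⟩) (⟨u₁, x₁⟩ | ⟨v₁, y₁⟩) x' y' h h' hx hy hne
    · exact absurd (congrArg Subtype.val h.1) hne
    · obtain ⟨x', rfl⟩ := (hpG u).exists_eq x' hx.symm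
      obtain ⟨y', rfl⟩ := (hpH v₁).exists_eq y' hy.symm
      rw [(hpG u).dist_eq hGconn]
      obtain ⟨e, hx, -⟩ := h
      obtain ⟨e', hx', -⟩ := h'
      -- Both new edges lie over the same edge of `T`, so they carry the same label and start in the
      -- same adhesion set.
      exact hNG _ _ hx _ hx'
    · obtain ⟨x', rfl⟩ := (hpH v).exists_eq x' hx.symm
      obtain ⟨y', rfl⟩ := (hpG u₁).exists_eq y' hy.symm
      rw [(hpH v).dist_eq hHconn]
      obtain ⟨e, hx, rfl⟩ := h
      obtain ⟨e', hx', rfl⟩ := h'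
      exact hNH _ _ (Subtype.property _) _ (Subtype.property _)
    · exact absurd (congrArg Subtype.val h.1) hne
  · intro x y z w hy hz hw h
    rcases hcover (treeVertex x) with hx | hx
    · exact (hpG ⟨_, hx⟩).thin hGconn hG rfl hy hz hw h
    · exact (hpH ⟨_, hx⟩).thin hHconn hH rfl hy hz hw h
  · intro x n
    rcases hcover (treeVertex x) with hx | hx
    · exact (hpG ⟨_, hx⟩).finite hGconn hGfin rfl n
    · exact (hpH ⟨_, hx⟩).finite hHconn hHfin rfl n

/-- The map on the disjoint union of all boundaries with given restrictions. -/
def pieceMap {D : Gluing A B T U V p q} (FT : Boundary T → Boundary (D.sumGraph G H))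
    (FG : U → Boundary G → Boundary (D.sumGraph G H))
    (FH : V → Boundary H → Boundary (D.sumGraph G H)) :
    PieceBoundary T U V G H → Boundary (D.sumGraph G H)
  | .inl η => FT η
  | .inr (.inl z) => FG z.1 z.2
  | .inr (.inr z) => FH z.1 z.2

end Amalgamation

end TreeAmalgam

/-! ### The main theorem -/

open TreeAmalgam in
theorem mainTheorem4 {A B W : Type*}
    (G : SimpleGraph A) (H : SimpleGraph B)
    (hGconn : G.Connected) (hHconn : H.Connected)
    (hGfin : IsLocallyFinite G) (hHfin : IsLocallyFinite H)
    (hGhyp : IsHyperbolic G) (hHhyp : IsHyperbolic H)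
    (hGqt : IsQuasiTransitive G) (hHqt : IsQuasiTransitive H)
    (T : SimpleGraph W) (U V : Set W) (p q : ℕ∞) (hT : IsSemiregularTree T U V p q)
    (D : Gluing A B T U V p q) (hD : D.BoundedAdhesion G H) :
    (D.sumGraph G H).Connected ∧ IsHyperbolic (D.sumGraph G H) ∧
      ∃ f : PieceBoundary T U V G H → Boundary (D.sumGraph G H),
        Function.Bijective f ∧
        ComponentsPullBack D f ∧
        RespectsPieces D f ∧
        RespectsTree D f ∧
        (∀ g : PieceBoundary T U V G H → Boundary (D.sumGraph G H),
          RespectsPieces D g → RespectsTree D g → g = f) := by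
  obtain ⟨δ₁, hδ₁⟩ := hGhyp.thinIntervals hGconn
  obtain ⟨δ₂, hδ₂⟩ := hHhyp.thinIntervals hHconn
  obtain ⟨N, hNG, hNH⟩ := hD
  have hG := hδ₁.mono (le_max_left δ₁ δ₂)
  have hH := hδ₂.mono (le_max_right δ₁ δ₂)
  have M := treeOfGraphs_sumGraph hGconn hHconn hGfin hHfin hT D hG hH hNG hNH
  obtain ⟨δ, hδ⟩ := M.thinIntervals
  have hTthin := thinIntervals_of_isTree hT.isTree
  have hpG := fun u : U => isPiece_left (G := G) (H := H) hT D u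
  have hpH := fun v : V => isPiece_right (G := G) (H := H) hT D v
  choose σ hσ using M.surjective
  obtain ⟨FT, hFT⟩ := M.exists_induces_section hσ
  choose FG hFG using fun u => M.exists_induces_piece (hpG u) hGconn hG
  choose FH hFH using fun v => M.exists_induces_piece (hpH v) hHconn hH
  have folT := M.follows_ray hσ hFT
  have folG := fun u => M.follows_fibre (hpG u) (hFG u)
  have folH := fun v => M.follows_fibre (hpH v) (hFH v)
  have injG : ∀ u, Function.Injective (FG u) := fun u => by
    obtain ⟨C, -, hC⟩ := M.gromovProduct_piece_le (hpG u) hGconn hG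
    exact (hFG u).injective hC M.connected hGconn hδ hG
  have injH : ∀ v, Function.Injective (FH v) := fun v => by
    obtain ⟨C, -, hC⟩ := M.gromovProduct_piece_le (hpH v) hHconn hH
    exact (hFH v).injective hC M.connected hHconn hδ hH
  -- A ray that visits some fibre infinitely often is a limit of that copy; one that visits every
  -- fibre only finitely often follows a ray of `T`.
  have hsurj : ∀ ξ, (∃ η, FT η = ξ) ∨ (∃ u η, FG u η = ξ) ∨ ∃ v η, FH v η = ξ := by
    intro ξ
    obtain ⟨s, rfl⟩ := exists_point_eq ξ
    by_cases hs : ∃ t, {n | treeVertex (s.vertex n) = t}.Infinite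
    · obtain ⟨t, ht⟩ := hs
      have htUV : t ∈ U ∪ V := hT.cover ▸ Set.mem_univ t
      rcases htUV with htU | htV
      · obtain ⟨r, hr⟩ := M.exists_piece_ray (hpG ⟨t, htU⟩) hGconn hGfin s ht
        exact Or.inr (Or.inl ⟨_, _, M.point_eq_of_coConvergent (hFG _) hr⟩)
      · obtain ⟨r, hr⟩ := M.exists_piece_ray (hpH ⟨t, htV⟩) hHconn hHfin s ht
        exact Or.inr (Or.inr ⟨_, _, M.point_eq_of_coConvergent (hFH _) hr⟩)
    · obtain ⟨r, hr⟩ := M.exists_tree_ray hσ s (not_exists.1 hs)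
      exact Or.inl ⟨_, M.point_eq_of_coConvergent hFT hr⟩
  -- separation of points by clopen sets
  have sepFibre : ∀ (a : W) ξ, (∀ (u : U) η, (u : W) = a → FG u η ≠ ξ) →
      (∀ (v : V) η, (v : W) = a → FH v η ≠ ξ) →
      ∃ O, IsClopen O ∧ ξ ∈ O ∧ ∀ ξ', Follows (D.sumGraph G H) treeVertex ξ' (fun _ => a) →
        ξ' ∉ O := by
    intro a ξ h₁ h₂
    rcases hsurj ξ with ⟨η, rfl⟩ | ⟨u, η, rfl⟩ | ⟨v, η, rfl⟩
    · obtain ⟨r, rfl⟩ := exists_point_eq η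
      exact M.exists_isClopen_ray_fibre r a (folT r)
    · exact M.exists_isClopen_fibre_fibre (fun h => h₁ u η h rfl) (folG u η)
    · exact M.exists_isClopen_fibre_fibre (fun h => h₂ v η h rfl) (folH v η)
  have sepTree : ∀ η ξ, ξ ≠ FT η → ∃ O, IsClopen O ∧ ξ ∈ O ∧ FT η ∉ O := by
    intro η ξ hne
    obtain ⟨r, rfl⟩ := exists_point_eq η
    have key : ∀ a, Follows (D.sumGraph G H) treeVertex ξ (fun _ => a) →
        ∃ O, IsClopen O ∧ ξ ∈ O ∧ FT r.point ∉ O := fun a ha => by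
      obtain ⟨O, h₁, h₂, h₃⟩ := M.exists_isClopen_ray_fibre r a (folT r)
      exact ⟨Oᶜ, h₁.compl, h₃ ξ ha, fun h => h h₂⟩
    rcases hsurj ξ with ⟨η', rfl⟩ | ⟨u, η', rfl⟩ | ⟨v, η', rfl⟩
    · obtain ⟨r', rfl⟩ := exists_point_eq η'
      exact M.exists_isClopen_ray_ray (fun h => hne (by rw [h])) (folT r') (folT r)
    · exact key u (folG u η')
    · exact key v (folH v η')
  -- Products in `Γ` are not bounded by those in `T` plus a constant, so injectivity is taken from
  -- the clopen separation of ends and not from `Induces.injective`.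
  have injT : Function.Injective FT := by
    intro η η' h
    obtain ⟨r, rfl⟩ := exists_point_eq η
    obtain ⟨r', rfl⟩ := exists_point_eq η'
    by_contra hne
    obtain ⟨O, -, h₁, h₂⟩ := M.exists_isClopen_ray_ray hne (folT r) (folT r')
    exact h₂ (h ▸ h₁)
  have neT : ∀ {a η ξ}, Follows (D.sumGraph G H) treeVertex ξ (fun _ => a) → FT η ≠ ξ := by
    rintro a η ξ hξ rfl
    obtain ⟨r, rfl⟩ := exists_point_eq η
    obtain ⟨O, -, h₁, h₂⟩ := M.exists_isClopen_ray_fibre r a (folT r)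
    exact h₂ _ hξ h₁
  have eqF : ∀ {a a' ξ}, Follows (D.sumGraph G H) treeVertex ξ (fun _ => a) →
      Follows (D.sumGraph G H) treeVertex ξ (fun _ => a') → a = a' := by
    intro a a' ξ h h'
    by_contra hne
    obtain ⟨O, -, h₁, h₂⟩ := M.exists_isClopen_fibre_fibre hne h
    exact h₂ _ h' h₁
  have hinj : Function.Injective (pieceMap FT FG FH) := by
    rintro (η | ⟨u, η⟩ | ⟨v, η⟩) (η' | ⟨u', η'⟩ | ⟨v', η'⟩) h
    · exact congrArg _ (injT h)
    · exact absurd h (neT (folG u' η'))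
    · exact absurd h (neT (folH v' η'))
    · exact absurd h.symm (neT (folG u η))
    · have h : FG u η = FG u' η' := h
      obtain rfl : u = u' := Subtype.ext (eqF (folG u η) (h ▸ folG u' η'))
      rw [injG u h]
    · have h : FG u η = FH v' η' := h
      exact absurd (eqF (folG u η) (h ▸ folH v' η')) (hT.ne u v')
    · exact absurd h.symm (neT (folH v η))
    · have h : FH v η = FG u' η' := h
      exact absurd (eqF (folH v η) (h ▸ folG u' η')).symm (hT.ne u' v)
    · have h : FH v η = FH v' η' := h
      obtain rfl : v = v' := Subtype.ext (eqF (folH v η) (h ▸ folH v' η'))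
      rw [injH v h]
  refine ⟨M.connected, hδ.isHyperbolic M.connected, pieceMap FT FG FH, ⟨hinj, ?_⟩, ?_,
    ⟨?_, ?_⟩, ?_, ?_⟩
  · intro ξ
    rcases hsurj ξ with ⟨η, h⟩ | ⟨u, η, h⟩ | ⟨v, η, h⟩
    · exact ⟨.inl η, h⟩
    · exact ⟨.inr (.inl (u, η)), h⟩
    · exact ⟨.inr (.inr (v, η)), h⟩
  · intro ξ
    rcases hsurj ξ with ⟨η, rfl⟩ | ⟨u, η, rfl⟩ | ⟨v, η, rfl⟩
    · refine Or.inl ⟨η, ?_⟩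
      rw [M.connectedComponent_section hσ hFT η (sepTree η)]
      have : FT '' connectedComponent η =
          pieceMap FT FG FH '' (ofTree U V G H '' connectedComponent η) := by
        rw [Set.image_image]; rfl
      rw [this, hinj.preimage_image]
    · refine Or.inr (Or.inl ⟨u, η, ?_⟩)
      rw [M.connectedComponent_piece (hpG u) hGconn hG (hFG u) (fun ξ hξ => sepFibre u ξ
        (fun u' η' hu h => hξ ⟨η', by rw [← h, Subtype.ext hu]⟩)
        (fun v η' hv _ => hT.ne u v hv.symm)) η]
      have : FG u '' connectedComponent η =
          pieceMap FT FG FH '' (ofLeft T V H u '' connectedComponent η) := by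
        rw [Set.image_image]; rfl
      rw [this, hinj.preimage_image]
    · refine Or.inr (Or.inr ⟨v, η, ?_⟩)
      rw [M.connectedComponent_piece (hpH v) hHconn hH (hFH v) (fun ξ hξ => sepFibre v ξ
        (fun u η' hu _ => hT.ne u v hu)
        (fun v' η' hv h => hξ ⟨η', by rw [← h, Subtype.ext hv]⟩)) η]
      have : FH v '' connectedComponent η =
          pieceMap FT FG FH '' (ofRight T U G v '' connectedComponent η) := by
        rw [Set.image_image]; rfl
      rw [this, hinj.preimage_image]
  · exact fun u x η hx => (hFG u).convergesTo (M.isGromovProper_piece (hpG u) hGconn)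
      M.connected hGconn hδ hG hx
  · exact fun v x η hx => (hFH v).convergesTo (M.isGromovProper_piece (hpH v) hHconn)
      M.connected hHconn hδ hH hx
  · exact fun z η hz => M.convergesTo_of_tree_convergesTo hσ hFT hz
  -- Every point of the pieces is the limit of a ray there, and the image of this ray under the
  -- inclusion or the section converges to the values of both maps.
  · intro g hgP hgT
    funext x
    rcases x with η | ⟨u, η⟩ | ⟨v, η⟩
    · obtain ⟨r, rfl⟩ := exists_point_eq η
      refine ConvergesTo.unique M.connected hδ (hgT (σ ∘ r.vertex) r.point ?_)
        (M.convergesTo_of_induces hFT r)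
      simpa only [Function.comp_apply, hσ] using r.convergesTo_point hT.isTree.1 hTthin
    · obtain ⟨r, rfl⟩ := exists_point_eq η
      exact ConvergesTo.unique M.connected hδ
        (hgP.1 u r.vertex r.point (r.convergesTo_point hGconn hG))
        (M.convergesTo_of_induces (hFG u) r)
    · obtain ⟨r, rfl⟩ := exists_point_eq η
      exact ConvergesTo.unique M.connected hδ
        (hgP.2 v r.vertex r.point (r.convergesTo_point hHconn hH))
        (M.convergesTo_of_induces (hFH v) r)
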